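/- Let $M$ be a compact smooth ($C^\infty$) Riemannian manifold without boundary, with Riemannian distance, and let $g:M\to M$ be a $C^1$ diffeomorphism. Definitions. Let $S\subset M$ be a set and let $E,F$ be continuous subbundles of $TM$ over $S$, of constant ranks, with $T_xM=E(x)\oplus F(x)$ for $x\in S$. The splitting $E\oplus F$ is *dominated* on a $g$-invariant set $\Lambda\subset S$ if over $\Lambda$ both $E$ and $F$ are $Dg$-invariant and there is an integer $L>0$ such that $$\frac{\|Dg^L_x(u)\|}{\|u\|}\le\frac12\,\frac{\|Dg^L_x(v)\|}{\|v\|}\qquad\text{for all }x\in\Lambda,\ 0\ne u\in E(x),\ 0\ne v\in F(x).$$ For $a>0$ and $x\in S$ put $C_a(F_x)=\{v_E+v_F:\ v_E\in E(x),\ v_F\in F(x),\ \|v_E\|<a\|v_F\|\}\cup\{0\}$. A *disk* is the image $D$ of the closed unit ball of $\mathbb R^{\dim F}$ under a $C^1$ embedding into $M$; a disk $D\subset S$ is *tangent to the $F$-cone* (of width $a$) if $T_xD\subset C_a(F_x)$ for every $x\in D$. Its volume expansion is $v_F(D)=\limsup_{n\to\infty}\frac1n\log\operatorname{vol}(g^n(D))$,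 where $\operatorname{vol}$ is the $(\dim F)$-dimensional Riemannian volume. For $K\subset M$, $h_{top}(g,K)$ denotes the (Bowen) topological entropy of $g$ on $K$, that is, $\lim_{\varepsilon\to0}\limsup_{n}\frac1n\log r_n(K,\varepsilon)$ with $r_n(K,\varepsilon)$ the smallest cardinality of an $(n,\varepsilon)$-spanning set of $K$, and $h_{top}(g)=h_{top}(g,M)$. Theorem. (1) Suppose that $g$ admits a dominated splitting $TM=E\oplus F$ on $M$. Then for every $a>0$, $$h_{top}(g)\ \ge\ v_F:=\sup\{v_F(D):\ D\text{ a disk tangent to the } F\text{-cone of width } a\}.$$ (2) Let $\Lambda\subset M$ be a compact set with $g(\Lambda)=\Lambda$, and let $E\oplus F$ be a continuous splitting of $TM$ over an open set $W\supset\Lambda$ which is dominated on $\Lambda$ (that is, a dominated splitting on $\Lambda$ extended continuously to a neighborhood of $\Lambda$; the extension need not be invariant outside $\Lambda$). Then for every $a>0$ there is an open set $U$ with $\Lambda\subset U\subset W$ such that for every $V\subset U$, $$h_{top}\Big(g,\ \bigcap_{n\ge0}g^{-n}(V)\Big)\ \ge\ v_F(V)\quad\text{and}\quad h_{top}(g)\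 \ge\ v_F(V),$$ where $v_F(V)$ is the supremum of $v_F(D)$ over all disks $D$ tangent to the $F$-cone of width $a$ with $g^n(D)\subset V$ for all $n\ge0$ (and $v_F(V)=-\infty$ if there is no such disk). -/

import Mathlib

open Set Filter Topology Manifold MeasureTheory Bundle
open scoped ContDiff

noncomputable section

namespace VolumeGrowth

variable {d : ℕ} {M : Type*} [EMetricSpace M] [ChartedSpace (EuclideanSpace ℝ (Fin d)) M]

/-- `F` is a continuous rank `r` subbundle of the tangent bundle over the set `S`: near every point
of `S` the spaces `F y`, `y ∈ S`, have a basis consisting of `r` continuous vector fields. -/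
def IsContinuousSubbundleOn [IsManifold (𝓡 d) 1 M]
    (F : (x : M) → Submodule ℝ (TangentSpace (𝓡 d) x)) (r : ℕ) (S : Set M) : Prop :=
  ∀ x ∈ S, ∃ N ∈ 𝓝 x, ∃ s : Fin r → (y : M) → TangentSpace (𝓡 d) y,
    (∀ i, ContinuousOn (fun y ↦ (⟨y, s i y⟩ : TangentBundle (𝓡 d) M)) (N ∩ S)) ∧
    ∀ y ∈ N ∩ S, LinearIndependent ℝ (fun i ↦ s i y) ∧
      Submodule.span ℝ (range fun i ↦ s i y) = F y

/-- `E ⊕ F` is a continuous splitting of the tangent bundle over the set `S`, with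
`rank E = m` and `rank F = k`. -/
structure IsContinuousSplittingOn [IsManifold (𝓡 d) 1 M]
    (E F : (x : M) → Submodule ℝ (TangentSpace (𝓡 d) x)) (m k : ℕ) (S : Set M) : Prop where
  continuous_left : IsContinuousSubbundleOn E m S
  continuous_right : IsContinuousSubbundleOn F k S
  isCompl : ∀ x ∈ S, IsCompl (E x) (F x)

section Metric

variable [RiemannianBundle (fun x : M ↦ TangentSpace (𝓡 d) x)]

/-- Over the set `S`, the splitting `E ⊕ F` is invariant under `Dg` and dominated: some iterate
`g ^ L` satisfies `‖Dg^L u‖ / ‖u‖ ≤ (1/2) ‖Dg^L v‖ / ‖v‖` for nonzero `u ∈ E x`, `v ∈ F x`. -/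
structure IsDominatedOn (g : M → M)
    (E F : (x : M) → Submodule ℝ (TangentSpace (𝓡 d) x)) (S : Set M) : Prop where
  map_left : ∀ x ∈ S, (E x).map (mfderiv (𝓡 d) (𝓡 d) g x).toLinearMap = E (g x)
  map_right : ∀ x ∈ S, (F x).map (mfderiv (𝓡 d) (𝓡 d) g x).toLinearMap = F (g x)
  dominated : ∃ L : ℕ, 0 < L ∧ ∀ x ∈ S, ∀ u ∈ E x, ∀ v ∈ F x, u ≠ 0 → v ≠ 0 →
    ‖mfderiv (𝓡 d) (𝓡 d) (g^[L]) x u‖ / ‖u‖ ≤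
      1 / 2 * (‖mfderiv (𝓡 d) (𝓡 d) (g^[L]) x v‖ / ‖v‖)

/-- The cone of width `a` around `F x`:
vectors `vE + vF` with `‖vE‖ < a ‖vF‖`, together with the zero vector. -/
def cone (E F : (x : M) → Submodule ℝ (TangentSpace (𝓡 d) x)) (a : ℝ) (x : M) :
    Set (TangentSpace (𝓡 d) x) :=
  {v | ∃ vE ∈ E x, ∃ vF ∈ F x, v = vE + vF ∧ ‖vE‖ < a * ‖vF‖} ∪ {0}

/-- `D` is a `C¹` disk of dimension `k`, that is, the image of the closed unit ball of `ℝᵏ` under a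
`C¹` embedding, and all its tangent spaces are contained in the cones of width `a` around `F`. -/
def IsDiskTangentToCone (E F : (x : M) → Submodule ℝ (TangentSpace (𝓡 d) x)) (k : ℕ) (a : ℝ)
    (D : Set M) : Prop :=
  ∃ φ : EuclideanSpace ℝ (Fin k) → M,
    ContMDiffOn (𝓡 k) (𝓡 d) 1 φ (Metric.closedBall 0 1) ∧
    InjOn φ (Metric.closedBall 0 1) ∧
    (∀ p ∈ Metric.closedBall (0 : EuclideanSpace ℝ (Fin k)) 1,
      Function.Injective (mfderivWithin (𝓡 k) (𝓡 d) φ (Metric.closedBall 0 1) p)) ∧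
    (∀ p ∈ Metric.closedBall (0 : EuclideanSpace ℝ (Fin k)) 1,
      ∀ w : TangentSpace (𝓡 k) p,
        mfderivWithin (𝓡 k) (𝓡 d) φ (Metric.closedBall 0 1) p w ∈ cone E F a (φ p)) ∧
    φ '' Metric.closedBall 0 1 = D

end Metric

variable [MeasurableSpace M] [BorelSpace M]

/-- The volume expansion `limsup (1/n) log vol (gⁿ D)` of a `k`-dimensional disk `D`. The
`k`-dimensional volume is the `k`-dimensional Hausdorff measure of the Riemannian distance,
normalized so that it is Lebesgue measure on `ℝᵏ`. -/
def diskVolumeExpansion (g : M → M) (k : ℕ) (D : Set M) : EReal :=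
  limsup (fun n : ℕ ↦ ENNReal.log (μHE[k] (g^[n] '' D)) / (n : EReal)) atTop

/-- The volume expansion of the rank `k` bundle `F` in the set `V`: the supremum of the volume
expansions of the disks tangent to the `F` cone all of whose forward iterates lie in `V`.
For `V = univ` these are all the disks tangent to the `F` cone. -/
def volumeExpansion [RiemannianBundle (fun x : M ↦ TangentSpace (𝓡 d) x)] (g : M → M)
    (E F : (x : M) → Submodule ℝ (TangentSpace (𝓡 d) x)) (k : ℕ) (a : ℝ) (V : Set M) : EReal :=
  ⨆ (D : Set M) (_ : IsDiskTangentToCone E F k a D ∧ ∀ n : ℕ, g^[n] '' D ⊆ V),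
    diskVolumeExpansion g k D

end VolumeGrowth

end

open VolumeGrowth

/-!
The volume of the iterates of a disk is compared with the number of dynamical balls needed to cover
the disk. The point is that the part of `gⁿ D` coming from one dynamical ball has volume bounded
independently of `n`. This is proved with differences of nearby points in place of tangent vectors,
so that no graph transform and no connectedness of the pieces of `gⁿ D` is needed.

Write `chartDiff (σ y) y z ∈ T_y M` for the vector pointing from `y` to `z` in a chart selected from
a finite family; it depends on the choice only up to an error which is small compared with the
distance of `y` and `z`. A pair `(y, z)` is in cone position (`IsConePair`) if this vector lies in
the cone of width `a` around `F y`.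

* Domination means that an iterate `G = g^L` maps the closed cones over `Λ` into the open ones
  (`IsDominatedOn.exists_iterate_cone`). By the differentiability of `G` and the continuity of the
  cones, `G` then preserves cone position of pairs of nearby points in a neighborhood of `Λ`
  (`eventually_isConePair_map`). Here and below, the argument passes to the limiting direction
  (`HasDirection`) of a hypothetical family of bad pairs, along an ultrafilter.
* A small set all of whose pairs are in cone position is a Lipschitz graph over a bounded subset of
  `ℝᵏ`, so it has bounded volume (`exists_measure_image_le_of_isConePair`).
* Two nearby points of a disk tangent to the cone field are in cone position
  (`IsDiskTangentToCone.exists_forall_isConePair`), by compactness of the disk.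

So two points of the disk which stay close up to time `n` are in cone position at all multiples of
`L` up to `n`. The piece of `gⁿ D` coming from one dynamical ball is therefore the image, under one
of the finitely many maps `g^r` with `r ≤ L`, of a small set in cone position, and its volume is
bounded. Summing over a minimal dynamical cover gives the inequality
(`diskVolumeExpansion_le_coverEntropy`). The case of a splitting over all of `M` is the case
`Λ = W = M`.
-/

namespace VolumeGrowth

/-! ### Limiting directions of pairs of points -/

section Direction

variable {ι : Type*} {d : ℕ} {M : Type*} [TopologicalSpace M]
  [ChartedSpace (EuclideanSpace ℝ (Fin d)) M]

/-- Rescaled differences pass to the limit under a map with a first order expansion. -/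
lemma tendsto_inv_smul_sub_of_isLittleO {V V' : Type*} [NormedAddCommGroup V] [NormedSpace ℝ V]
    [NormedAddCommGroup V'] [NormedSpace ℝ V'] {l : Filter ι} {h : V → V'} {h' : V →L[ℝ] V'}
    {a b : ι → V} {r : ι → ℝ} {θ : V}
    (ho : (fun j ↦ h (b j) - h (a j) - h' (b j - a j)) =o[l] fun j ↦ b j - a j)
    (hθ : Tendsto (fun j ↦ (r j)⁻¹ • (b j - a j)) l (𝓝 θ)) :
    Tendsto (fun j ↦ (r j)⁻¹ • (h (b j) - h (a j))) l (𝓝 (h' θ)) := by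
  have h1 : (fun j ↦ (r j)⁻¹ • (h (b j) - h (a j) - h' (b j - a j))) =o[l] (fun _ ↦ (1 : ℝ)) :=
    ((Asymptotics.isBigO_refl (fun j ↦ (r j)⁻¹) l).smul_isLittleO ho).trans_isBigO
      (hθ.isBigO_one ℝ)
  have h2 := (Asymptotics.isLittleO_one_iff ℝ).1 h1
  have h3 := h2.add ((h'.continuous.tendsto θ).comp hθ)
  rw [zero_add] at h3
  refine h3.congr fun j ↦ ?_
  simp only [Function.comp_apply, map_smul]
  rw [← smul_add, sub_add_cancel]

/-- Along the filter `l`, the pairs `(y j, z j)` converge to `(x, x)` and their coordinate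
differences in the preferred chart at `x`, rescaled by `r j`, converge to `θ`. The vector `θ` is
meant as an element of the tangent space at `x`, which is trivialized by this chart. -/
structure HasDirection (l : Filter ι) (y z : ι → M) (r : ι → ℝ) (x : M)
    (θ : EuclideanSpace ℝ (Fin d)) : Prop where
  tendsto_left : Tendsto y l (𝓝 x)
  tendsto_right : Tendsto z l (𝓝 x)
  tendsto_diff : Tendsto
    (fun j ↦ (r j)⁻¹ • (extChartAt (𝓡 d) x (z j) - extChartAt (𝓡 d) x (y j))) l (𝓝 θ)

/-- Along an ultrafilter, pairs of distinct points converging to the diagonal have a direction. -/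
lemma exists_hasDirection {l : Ultrafilter ι} {y z : ι → M} {x : M} (hy : Tendsto y l (𝓝 x))
    (hz : Tendsto z l (𝓝 x)) (hne : ∀ᶠ j in (l : Filter ι), y j ≠ z j) :
    (∀ᶠ j in (l : Filter ι), 0 < ‖extChartAt (𝓡 d) x (z j) - extChartAt (𝓡 d) x (y j)‖) ∧
    ∃ θ : EuclideanSpace ℝ (Fin d), θ ≠ 0 ∧ HasDirection (l : Filter ι) y z
      (fun j ↦ ‖extChartAt (𝓡 d) x (z j) - extChartAt (𝓡 d) x (y j)‖) x θ := by
  have hpos : ∀ᶠ j in (l : Filter ι),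
      0 < ‖extChartAt (𝓡 d) x (z j) - extChartAt (𝓡 d) x (y j)‖ := by
    filter_upwards [hne, hy (extChartAt_source_mem_nhds (I := 𝓡 d) x),
      hz (extChartAt_source_mem_nhds (I := 𝓡 d) x)] with j h1 h2 h3
    rw [norm_pos_iff, sub_ne_zero]
    exact fun h ↦ h1 ((extChartAt (𝓡 d) x).injOn h3 h2 h).symm
  refine ⟨hpos, ?_⟩
  set w : ι → EuclideanSpace ℝ (Fin d) := fun j ↦
    (‖extChartAt (𝓡 d) x (z j) - extChartAt (𝓡 d) x (y j)‖)⁻¹ •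
      (extChartAt (𝓡 d) x (z j) - extChartAt (𝓡 d) x (y j)) with hw
  have hsph : ∀ᶠ j in (l : Filter ι), w j ∈ Metric.sphere (0 : EuclideanSpace ℝ (Fin d)) 1 := by
    filter_upwards [hpos] with j hj
    rw [mem_sphere_zero_iff_norm, hw, norm_smul, norm_inv, norm_norm, inv_mul_cancel₀ hj.ne']
  obtain ⟨θ, hθ, hlim⟩ := (isCompact_sphere (0 : EuclideanSpace ℝ (Fin d)) 1).ultrafilter_le_nhds
    (l.map w) (tendsto_principal.2 hsph)
  refine ⟨θ, ?_, hy, hz, hlim⟩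
  rw [mem_sphere_zero_iff_norm] at hθ
  exact norm_ne_zero_iff.1 (by rw [hθ]; exact one_ne_zero)

lemma hasStrictFDerivAt_writtenInExtChartAt {G : M → M} {x : M}
    (hG : ContMDiffAt (𝓡 d) (𝓡 d) 1 G x) :
    HasStrictFDerivAt (𝕜 := ℝ) (E := EuclideanSpace ℝ (Fin d)) (F := EuclideanSpace ℝ (Fin d))
      (writtenInExtChartAt (𝓡 d) (𝓡 d) x G) (mfderiv (𝓡 d) (𝓡 d) G x) (extChartAt (𝓡 d) x x) := by
  let A : EuclideanSpace ℝ (Fin d) →L[ℝ] EuclideanSpace ℝ (Fin d) := mfderiv (𝓡 d) (𝓡 d) G x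
  have h1 := (contMDiffAt_iff.1 hG).2
  rw [ModelWithCorners.Boundaryless.range_eq_univ, contDiffWithinAt_univ] at h1
  have h2 : HasFDerivWithinAt (writtenInExtChartAt (𝓡 d) (𝓡 d) x G) A
      (range (𝓡 d)) (extChartAt (𝓡 d) x x) :=
    (hG.mdifferentiableAt one_ne_zero).hasMFDerivAt.2
  rw [ModelWithCorners.Boundaryless.range_eq_univ, hasFDerivWithinAt_univ] at h2
  exact h1.hasStrictFDerivAt' h2 one_ne_zero

/-- Directions are transported by the derivative of a `C¹` map. -/
lemma HasDirection.map {l : Filter ι} {y z : ι → M} {r : ι → ℝ} {x : M}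
    {θ : EuclideanSpace ℝ (Fin d)} (h : HasDirection l y z r x θ) {G : M → M}
    (hG : ContMDiffAt (𝓡 d) (𝓡 d) 1 G x) :
    HasDirection l (fun j ↦ G (y j)) (fun j ↦ G (z j)) r (G x)
      (mfderiv (𝓡 d) (𝓡 d) G x θ) := by
  have hGc := hG.continuousAt
  refine ⟨hGc.tendsto.comp h.tendsto_left, hGc.tendsto.comp h.tendsto_right, ?_⟩
  have hs := hasStrictFDerivAt_writtenInExtChartAt hG
  have hc := continuousAt_extChartAt (I := 𝓡 d) x
  have ho := hs.isLittleO.comp_tendsto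
    ((hc.tendsto.comp h.tendsto_right).prodMk_nhds (hc.tendsto.comp h.tendsto_left))
  refine (tendsto_inv_smul_sub_of_isLittleO ho h.tendsto_diff).congr' ?_
  filter_upwards [h.tendsto_left (extChartAt_source_mem_nhds (I := 𝓡 d) x),
    h.tendsto_right (extChartAt_source_mem_nhds (I := 𝓡 d) x)] with j h1 h2
  simp only [writtenInExtChartAt, Function.comp_apply, (extChartAt (𝓡 d) x).left_inv h1,
    (extChartAt (𝓡 d) x).left_inv h2]

lemma exists_eventually_norm_extChartAt_map_sub_le {G : M → M} {x : M}
    (hG : ContMDiffAt (𝓡 d) (𝓡 d) 1 G x) : ∃ K : ℝ, 0 < K ∧ ∀ᶠ q : M × M in 𝓝 (x, x),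
      ‖extChartAt (𝓡 d) (G x) (G q.2) - extChartAt (𝓡 d) (G x) (G q.1)‖ ≤
        K * ‖extChartAt (𝓡 d) x q.2 - extChartAt (𝓡 d) x q.1‖ := by
  have hc := continuousAt_extChartAt (I := 𝓡 d) x
  have h1 : Tendsto (fun q : M × M ↦ (extChartAt (𝓡 d) x q.2, extChartAt (𝓡 d) x q.1))
      (𝓝 (x, x)) (𝓝 (extChartAt (𝓡 d) x x, extChartAt (𝓡 d) x x)) :=
    (hc.tendsto.comp (continuous_snd.tendsto (x, x))).prodMk_nhds
      (hc.tendsto.comp (continuous_fst.tendsto (x, x)))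
  obtain ⟨K, hK, h2⟩ :=
    ((hasStrictFDerivAt_writtenInExtChartAt hG).isBigO_sub.comp_tendsto h1).exists_pos
  refine ⟨K, hK, ?_⟩
  have hsrc := extChartAt_source_mem_nhds (I := 𝓡 d) x
  filter_upwards [h2.bound, (continuous_fst.tendsto (x, x)) hsrc,
    (continuous_snd.tendsto (x, x)) hsrc] with q hq hq1 hq2
  simpa only [writtenInExtChartAt, Function.comp_apply, (extChartAt (𝓡 d) x).left_inv hq1,
    (extChartAt (𝓡 d) x).left_inv hq2] using hq

variable [IsManifold (𝓡 d) 1 M]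

/-- Convergence in the tangent bundle, in coordinates. -/
lemma tendsto_tangentBundle_iff {l : Filter ι} {p : ι → M} {t : ∀ j, TangentSpace (𝓡 d) (p j)}
    {x : M} {θ : TangentSpace (𝓡 d) x} :
    Tendsto (fun j ↦ (⟨p j, t j⟩ : TangentBundle (𝓡 d) M)) l (𝓝 ⟨x, θ⟩) ↔
      Tendsto p l (𝓝 x) ∧ Tendsto (fun j ↦ (tangentCoordChange (𝓡 d) (p j) x (p j) (t j)))
        l (𝓝 (θ : EuclideanSpace ℝ (Fin d))) := by
  rw [(trivializationAt (EuclideanSpace ℝ (Fin d)) (TangentSpace (𝓡 d)) x).tendsto_nhds_iff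
    (by simp)]
  refine Iff.and Iff.rfl ?_
  have : (trivializationAt (EuclideanSpace ℝ (Fin d)) (TangentSpace (𝓡 d)) x
      (⟨x, θ⟩ : TangentBundle (𝓡 d) M)).2 = θ :=
    tangentCoordChange_self (I := 𝓡 d) (mem_extChartAt_source x)
  rw [this]
  rfl

lemma hasStrictFDerivAt_extChartAt_comp_symm {x i : M} (hx : x ∈ (extChartAt (𝓡 d) i).source) :
    HasStrictFDerivAt (extChartAt (𝓡 d) i ∘ (extChartAt (𝓡 d) x).symm)
      (tangentCoordChange (𝓡 d) x i x) (extChartAt (𝓡 d) x x) := by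
  have h' : extChartAt (𝓡 d) x x ∈
      ((extChartAt (𝓡 d) x).symm ≫ (extChartAt (𝓡 d) i)).source := by
    rw [PartialEquiv.trans_source'', PartialEquiv.symm_symm, PartialEquiv.symm_target]
    exact mem_image_of_mem _ ⟨mem_extChartAt_source x, hx⟩
  have h1 := contDiffWithinAt_ext_coord_change (I := 𝓡 d) (n := 1) i x h'
  rw [ModelWithCorners.Boundaryless.range_eq_univ, contDiffWithinAt_univ] at h1
  have h2 := hasFDerivWithinAt_tangentCoordChange (I := 𝓡 d) ⟨mem_extChartAt_source x, hx⟩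
  rw [ModelWithCorners.Boundaryless.range_eq_univ, hasFDerivWithinAt_univ] at h2
  exact h1.hasStrictFDerivAt' h2 one_ne_zero

lemma HasDirection.tendsto_extChartAt_sub {l : Filter ι} {y z : ι → M} {r : ι → ℝ} {x i : M}
    {θ : EuclideanSpace ℝ (Fin d)} (h : HasDirection l y z r x θ)
    (hx : x ∈ (extChartAt (𝓡 d) i).source) :
    Tendsto (fun j ↦ (r j)⁻¹ • (extChartAt (𝓡 d) i (z j) - extChartAt (𝓡 d) i (y j))) l
      (𝓝 (tangentCoordChange (𝓡 d) x i x θ)) := by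
  have hc := continuousAt_extChartAt (I := 𝓡 d) x
  have ho := (hasStrictFDerivAt_extChartAt_comp_symm hx).isLittleO.comp_tendsto
    ((hc.tendsto.comp h.tendsto_right).prodMk_nhds (hc.tendsto.comp h.tendsto_left))
  refine (tendsto_inv_smul_sub_of_isLittleO ho h.tendsto_diff).congr' ?_
  filter_upwards [h.tendsto_left (extChartAt_source_mem_nhds (I := 𝓡 d) x),
    h.tendsto_right (extChartAt_source_mem_nhds (I := 𝓡 d) x)] with j h1 h2
  simp only [Function.comp_apply, (extChartAt (𝓡 d) x).left_inv h1,
    (extChartAt (𝓡 d) x).left_inv h2]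

/-- The tangent vector at `y` pointing to `z` in the preferred chart at `i`: a substitute for the
inverse of the exponential map. -/
noncomputable def chartDiff (i y z : M) : TangentSpace (𝓡 d) y :=
  tangentCoordChange (𝓡 d) i y y (extChartAt (𝓡 d) i z - extChartAt (𝓡 d) i y)

/-- The rescaled tangent vectors `chartDiff i y z` converge to the direction of the pairs,
whichever chart `i` is used. -/
lemma HasDirection.tendsto_chartDiff {l : Filter ι} {y z : ι → M} {r : ι → ℝ} {x i : M}
    {θ : EuclideanSpace ℝ (Fin d)} (h : HasDirection l y z r x θ)
    (hx : x ∈ (extChartAt (𝓡 d) i).source) :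
    Tendsto (fun j ↦ (⟨y j, (r j)⁻¹ • chartDiff i (y j) (z j)⟩ : TangentBundle (𝓡 d) M)) l
      (𝓝 ⟨x, θ⟩) := by
  refine tendsto_tangentBundle_iff.2 ⟨h.tendsto_left, ?_⟩
  have hxx := mem_extChartAt_source (I := 𝓡 d) x
  have hcont : ContinuousAt (tangentCoordChange (𝓡 d) i x) x :=
    (continuousOn_tangentCoordChange i x).continuousAt
      (inter_mem ((isOpen_extChartAt_source i).mem_nhds hx) (extChartAt_source_mem_nhds x))
  have h1 := (isBoundedBilinearMap_apply (𝕜 := ℝ) (E := EuclideanSpace ℝ (Fin d))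
    (F := EuclideanSpace ℝ (Fin d))).continuous.continuousAt.tendsto.comp
    ((hcont.tendsto.comp h.tendsto_left).prodMk_nhds (h.tendsto_extChartAt_sub hx))
  have h2 : tangentCoordChange (𝓡 d) i x x (tangentCoordChange (𝓡 d) x i x θ) = θ := by
    rw [tangentCoordChange_comp ⟨⟨hxx, hx⟩, hxx⟩, tangentCoordChange_self hxx]
  simp only [h2] at h1
  refine h1.congr' ?_
  filter_upwards [h.tendsto_left (extChartAt_source_mem_nhds (I := 𝓡 d) x),
    h.tendsto_left ((isOpen_extChartAt_source (I := 𝓡 d) i).mem_nhds hx)] with j hj hj'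
  have h3 := tangentCoordChange_comp (I := 𝓡 d) (w := i) (x := y j) (y := x) (z := y j)
    (v := (r j)⁻¹ • (extChartAt (𝓡 d) i (z j) - extChartAt (𝓡 d) i (y j)))
    ⟨⟨hj', mem_extChartAt_source _⟩, hj⟩
  rw [map_smul (tangentCoordChange (𝓡 d) i (y j) (y j))] at h3
  exact h3.symm

end Direction

/-! ### Continuity of the components in a splitting -/

section ConeHomogeneity

variable {d : ℕ} {M : Type*} [EMetricSpace M] [ChartedSpace (EuclideanSpace ℝ (Fin d)) M]
  [RiemannianBundle (fun x : M ↦ TangentSpace (𝓡 d) x)]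
  {E F : (x : M) → Submodule ℝ (TangentSpace (𝓡 d) x)}

lemma smul_mem_cone {a c : ℝ} (hc : 0 < c) {x : M} {t : TangentSpace (𝓡 d) x}
    (ht : t ∈ cone E F a x) : c • t ∈ cone E F a x := by
  rcases ht with ⟨u, hu, v, hv, rfl, h⟩ | rfl
  · refine Or.inl ⟨c • u, (E x).smul_mem c hu, c • v, (F x).smul_mem c hv, smul_add _ _ _, ?_⟩
    rw [norm_smul, norm_smul, Real.norm_of_nonneg hc.le]
    nlinarith
  · exact Or.inr (smul_zero c)

lemma smul_mem_cone_iff {a c : ℝ} (hc : 0 < c) {x : M} {t : TangentSpace (𝓡 d) x} :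
    c • t ∈ cone E F a x ↔ t ∈ cone E F a x :=
  ⟨fun h ↦ by simpa [smul_smul, hc.ne'] using smul_mem_cone (inv_pos.2 hc) h, smul_mem_cone hc⟩

end ConeHomogeneity

section Splitting

variable {ι : Type*} {d : ℕ} {M : Type*} [EMetricSpace M]
  [ChartedSpace (EuclideanSpace ℝ (Fin d)) M] [IsManifold (𝓡 d) 1 M]
  {E F : (x : M) → Submodule ℝ (TangentSpace (𝓡 d) x)} {m k : ℕ} {W : Set M}

/-- If `Φ j` are linear maps converging to an isomorphism, convergence of `Φ j (γ j)` forces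
convergence of `γ j`. -/
lemma tendsto_of_tendsto_clm_apply {V V' : Type*} [NormedAddCommGroup V] [NormedSpace ℝ V]
    [CompleteSpace V] [NormedAddCommGroup V'] [NormedSpace ℝ V'] {l : Filter ι} {Φ : ι → V →L[ℝ] V'}
    {Φ₀ : V ≃L[ℝ] V'} (hΦ : Tendsto Φ l (𝓝 Φ₀)) {γ : ι → V} {γ₀ : V}
    (h : Tendsto (fun j ↦ Φ j (γ j)) l (𝓝 (Φ₀ γ₀))) : Tendsto γ l (𝓝 γ₀) := by
  have hinv : ContinuousAt ContinuousLinearMap.inverse (Φ₀ : V →L[ℝ] V') :=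
    (contDiffAt_map_inverse (n := 0) Φ₀).continuousAt
  have h1 := (isBoundedBilinearMap_apply (𝕜 := ℝ) (E := V')
    (F := V)).continuous.continuousAt.tendsto.comp ((hinv.tendsto.comp hΦ).prodMk_nhds h)
  simp only [ContinuousLinearMap.inverse_equiv, ContinuousLinearEquiv.coe_coe,
    ContinuousLinearEquiv.symm_apply_apply] at h1
  refine h1.congr' ?_
  filter_upwards [hΦ (ContinuousLinearEquiv.nhds Φ₀)] with j hj
  obtain ⟨e, he⟩ := hj
  simp only [Function.comp_apply, ← he, ContinuousLinearMap.inverse_equiv,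
    ContinuousLinearEquiv.coe_coe, ContinuousLinearEquiv.symm_apply_apply]

/-- The linear combination of two families of vectors, as a continuous linear map of the
coefficients. -/
noncomputable def combination {m k : ℕ} {V : Type*} [NormedAddCommGroup V] [NormedSpace ℝ V]
    (S : Fin m → V) (S' : Fin k → V) : ((Fin m → ℝ) × (Fin k → ℝ)) →L[ℝ] V :=
  (∑ i, (ContinuousLinearMap.proj (R := ℝ) (φ := fun _ : Fin m ↦ ℝ) i ∘L
      ContinuousLinearMap.fst ℝ _ _).smulRight (S i)) +
    ∑ i, (ContinuousLinearMap.proj (R := ℝ) (φ := fun _ : Fin k ↦ ℝ) i ∘L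
      ContinuousLinearMap.snd ℝ _ _).smulRight (S' i)

lemma combination_apply {m k : ℕ} {V : Type*} [NormedAddCommGroup V] [NormedSpace ℝ V]
    (S : Fin m → V) (S' : Fin k → V) (c : (Fin m → ℝ) × (Fin k → ℝ)) :
    combination S S' c = ∑ i, c.1 i • S i + ∑ i, c.2 i • S' i := by
  simp [combination]

lemma tendsto_combination {m k : ℕ} {V : Type*} [NormedAddCommGroup V] [NormedSpace ℝ V]
    {l : Filter ι} {S : ι → Fin m → V} {S' : ι → Fin k → V} {S₀ : Fin m → V} {S₀' : Fin k → V}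
    (h : ∀ i, Tendsto (fun j ↦ S j i) l (𝓝 (S₀ i)))
    (h' : ∀ i, Tendsto (fun j ↦ S' j i) l (𝓝 (S₀' i))) :
    Tendsto (fun j ↦ combination (S j) (S' j)) l (𝓝 (combination S₀ S₀')) := by
  refine Tendsto.add (tendsto_finsetSum _ fun i _ ↦ ?_) (tendsto_finsetSum _ fun i _ ↦ ?_)
  · exact ((ContinuousLinearMap.smulRightL ℝ _ V _).continuous.tendsto _).comp (h i)
  · exact ((ContinuousLinearMap.smulRightL ℝ _ V _).continuous.tendsto _).comp (h' i)

/-- The components of convergent tangent vectors in a continuous splitting converge. -/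
lemma IsContinuousSplittingOn.tendsto_components (hS : IsContinuousSplittingOn E F m k W)
    (hW : IsOpen W) {l : Filter ι} [l.NeBot] {p : ι → M} {u v : ∀ j, TangentSpace (𝓡 d) (p j)}
    (hp : ∀ᶠ j in l, u j ∈ E (p j) ∧ v j ∈ F (p j)) {x : M} (hx : x ∈ W)
    {u₀ v₀ : TangentSpace (𝓡 d) x} (hu₀ : u₀ ∈ E x) (hv₀ : v₀ ∈ F x)
    (h : Tendsto (fun j ↦ (⟨p j, u j + v j⟩ : TangentBundle (𝓡 d) M)) l (𝓝 ⟨x, u₀ + v₀⟩)) :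
    Tendsto (fun j ↦ (⟨p j, u j⟩ : TangentBundle (𝓡 d) M)) l (𝓝 ⟨x, u₀⟩) ∧
      Tendsto (fun j ↦ (⟨p j, v j⟩ : TangentBundle (𝓡 d) M)) l (𝓝 ⟨x, v₀⟩) := by
  obtain ⟨N, hN, s, hs, hsE⟩ := hS.continuous_left x hx
  obtain ⟨N', hN', s', hs', hsF⟩ := hS.continuous_right x hx
  have hpx := (tendsto_tangentBundle_iff.1 h).1
  have hxN : x ∈ N ∩ W := ⟨mem_of_mem_nhds hN, hx⟩
  have hxN' : x ∈ N' ∩ W := ⟨mem_of_mem_nhds hN', hx⟩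
  have hNW : ∀ᶠ y in 𝓝 x, y ∈ N ∩ W := inter_mem hN (hW.mem_nhds hx)
  have hNW' : ∀ᶠ y in 𝓝 x, y ∈ N' ∩ W := inter_mem hN' (hW.mem_nhds hx)
  let T : M → EuclideanSpace ℝ (Fin d) →L[ℝ] EuclideanSpace ℝ (Fin d) :=
    fun y ↦ tangentCoordChange (𝓡 d) y x y
  have hTx : ∀ w, T x w = w := fun w ↦ tangentCoordChange_self (mem_extChartAt_source x)
  -- the frames in the coordinates at `x`
  let S : M → Fin m → EuclideanSpace ℝ (Fin d) := fun y i ↦ T y (s i y)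
  let S' : M → Fin k → EuclideanSpace ℝ (Fin d) := fun y i ↦ T y (s' i y)
  have hSc : ∀ i, Tendsto (fun y ↦ S y i) (𝓝 x) (𝓝 (S x i)) := fun i ↦ by
    have h1 : ContinuousAt (fun y ↦ (⟨y, s i y⟩ : TangentBundle (𝓡 d) M)) x :=
      (hs i).continuousAt hNW
    have h2 := (tendsto_tangentBundle_iff.1 h1).2
    rwa [show S x i = s i x from hTx _]
  have hSc' : ∀ i, Tendsto (fun y ↦ S' y i) (𝓝 x) (𝓝 (S' x i)) := fun i ↦ by
    have h1 : ContinuousAt (fun y ↦ (⟨y, s' i y⟩ : TangentBundle (𝓡 d) M)) x :=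
      (hs' i).continuousAt hNW'
    have h2 := (tendsto_tangentBundle_iff.1 h1).2
    rwa [show S' x i = s' i x from hTx _]
  -- coefficients in the frames
  have hcoefE : ∀ y ∈ N ∩ W, ∀ w ∈ E y, ∃ c : Fin m → ℝ, w = ∑ i, c i • s i y := by
    intro y hy w hw
    rw [← (hsE y hy).2, Submodule.mem_span_range_iff_exists_fun] at hw
    exact hw.imp fun c hc ↦ hc.symm
  have hcoefF : ∀ y ∈ N' ∩ W, ∀ w ∈ F y, ∃ c : Fin k → ℝ, w = ∑ i, c i • s' i y := by
    intro y hy w hw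
    rw [← (hsF y hy).2, Submodule.mem_span_range_iff_exists_fun] at hw
    exact hw.imp fun c hc ↦ hc.symm
  have hTsum : ∀ (y : M) (c : Fin m → ℝ), T y (∑ i, c i • s i y : TangentSpace (𝓡 d) y) =
      ∑ i, c i • S y i := fun y c ↦ by
    refine (map_sum (T y) _ _).trans (Finset.sum_congr rfl fun i _ ↦ ?_)
    exact (T y).map_smul _ _
  have hTsum' : ∀ (y : M) (c : Fin k → ℝ), T y (∑ i, c i • s' i y : TangentSpace (𝓡 d) y) =
      ∑ i, c i • S' y i := fun y c ↦ by
    refine (map_sum (T y) _ _).trans (Finset.sum_congr rfl fun i _ ↦ ?_)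
    exact (T y).map_smul _ _
  have hcoef : ∀ᶠ j in l, ∃ c : (Fin m → ℝ) × (Fin k → ℝ),
      u j = ∑ i, c.1 i • s i (p j) ∧ v j = ∑ i, c.2 i • s' i (p j) := by
    filter_upwards [hp, hpx hNW, hpx hNW'] with j hj h1 h2
    obtain ⟨c, hc⟩ := hcoefE _ h1 _ hj.1
    obtain ⟨c', hc'⟩ := hcoefF _ h2 _ hj.2
    exact ⟨(c, c'), hc, hc'⟩
  obtain ⟨γ, hγ⟩ := hcoef.choice
  obtain ⟨α₀, hα₀⟩ := hcoefE x hxN u₀ hu₀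
  obtain ⟨β₀, hβ₀⟩ := hcoefF x hxN' v₀ hv₀
  have hΦ := (tendsto_combination hSc hSc').comp hpx
  have hSsum : ∀ c : Fin m → ℝ, ∑ i, c i • S x i = (∑ i, c i • s i x : TangentSpace (𝓡 d) x) :=
    fun c ↦ (hTsum x c).symm.trans (hTx _)
  have hSsum' : ∀ c : Fin k → ℝ, ∑ i, c i • S' x i = (∑ i, c i • s' i x : TangentSpace (𝓡 d) x) :=
    fun c ↦ (hTsum' x c).symm.trans (hTx _)
  have hSx : ∀ c : (Fin m → ℝ) × (Fin k → ℝ), combination (S x) (S' x) c =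
      ((∑ i, c.1 i • s i x + ∑ i, c.2 i • s' i x : TangentSpace (𝓡 d) x)) := fun c ↦ by
    rw [combination_apply, hSsum, hSsum']
    rfl
  have hEspan : ∀ c : Fin m → ℝ, (∑ i, c i • s i x : TangentSpace (𝓡 d) x) ∈ E x := fun c ↦ by
    rw [← (hsE x hxN).2, Submodule.mem_span_range_iff_exists_fun]
    exact ⟨c, rfl⟩
  have hFspan : ∀ c : Fin k → ℝ, (∑ i, c i • s' i x : TangentSpace (𝓡 d) x) ∈ F x := fun c ↦ by
    rw [← (hsF x hxN').2, Submodule.mem_span_range_iff_exists_fun]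
    exact ⟨c, rfl⟩
  have hbij : Function.Bijective (combination (S x) (S' x)) := by
    constructor
    · refine (injective_iff_map_eq_zero _).2 fun c hc ↦ ?_
      have h0 : (∑ i, c.1 i • s i x + ∑ i, c.2 i • s' i x : TangentSpace (𝓡 d) x) = 0 :=
        (hSx c).symm.trans hc
      have hE0 := Submodule.disjoint_def.1 (hS.isCompl x hx).disjoint _ (hEspan c.1)
        (by rw [eq_neg_of_add_eq_zero_left h0]; exact (F x).neg_mem (hFspan c.2))
      rw [hE0, zero_add] at h0
      exact Prod.ext (funext (Fintype.linearIndependent_iff.1 (hsE x hxN).1 c.1 hE0))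
        (funext (Fintype.linearIndependent_iff.1 (hsF x hxN').1 c.2 h0))
    · intro w
      have htop : ∀ t : TangentSpace (𝓡 d) x, t ∈ E x ⊔ F x := fun t ↦ by
        rw [(hS.isCompl x hx).sup_eq_top]; trivial
      obtain ⟨w₁, h1, w₂, h2, hw⟩ := Submodule.mem_sup.1 (htop w)
      obtain ⟨c, hc⟩ := hcoefE x hxN w₁ h1
      obtain ⟨c', hc'⟩ := hcoefF x hxN' w₂ h2
      refine ⟨(c, c'), (hSx _).trans ?_⟩
      simp only [← hc, ← hc']
      exact hw
  let Φ₀ : ((Fin m → ℝ) × (Fin k → ℝ)) ≃L[ℝ] EuclideanSpace ℝ (Fin d) :=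
    (LinearEquiv.ofBijective (combination (S x) (S' x)).toLinearMap hbij).toContinuousLinearEquiv
  have hΦ₀ : (Φ₀ : ((Fin m → ℝ) × (Fin k → ℝ)) →L[ℝ] EuclideanSpace ℝ (Fin d)) =
      combination (S x) (S' x) := by
    ext1 <;> rfl
  have hlim : Tendsto γ l (𝓝 (α₀, β₀)) := by
    refine tendsto_of_tendsto_clm_apply (Φ₀ := Φ₀) (by rw [hΦ₀]; exact hΦ) ?_
    have h2 := (tendsto_tangentBundle_iff.1 h).2
    have h3 : Φ₀ (α₀, β₀) = u₀ + v₀ := by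
      refine (hSx (α₀, β₀)).trans ?_
      simp only [← hα₀, ← hβ₀]
      rfl
    rw [h3]
    refine h2.congr' ?_
    filter_upwards [hγ] with j hj
    simp only [Function.comp_apply]
    rw [combination_apply, ← hTsum, ← hTsum', ← hj.1, ← hj.2]
    exact (T (p j)).map_add _ _
  constructor
  · refine tendsto_tangentBundle_iff.2 ⟨hpx, ?_⟩
    have h1 : Tendsto (fun j ↦ ∑ i, (γ j).1 i • S (p j) i) l (𝓝 (∑ i, α₀ i • S x i)) :=
      tendsto_finsetSum _ fun i _ ↦
        (((continuous_apply i).tendsto α₀).comp hlim.fst_nhds).smul ((hSc i).comp hpx)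
    rw [hSsum, ← hα₀] at h1
    refine h1.congr' ?_
    filter_upwards [hγ] with j hj
    rw [← hTsum, ← hj.1]
  · refine tendsto_tangentBundle_iff.2 ⟨hpx, ?_⟩
    have h1 : Tendsto (fun j ↦ ∑ i, (γ j).2 i • S' (p j) i) l (𝓝 (∑ i, β₀ i • S' x i)) :=
      tendsto_finsetSum _ fun i _ ↦
        (((continuous_apply i).tendsto β₀).comp hlim.snd_nhds).smul ((hSc' i).comp hpx)
    rw [hSsum', ← hβ₀] at h1
    refine h1.congr' ?_
    filter_upwards [hγ] with j hj
    rw [← hTsum', ← hj.2]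

/-- At each point there is a linear map to `ℝᵏ` whose kernel is contained in the complement `E x` of
`F x`, namely the projection along `E x` followed by an isomorphism. -/
lemma IsContinuousSplittingOn.exists_clm_ker (hS : IsContinuousSplittingOn E F m k W) {x : M}
    (hx : x ∈ W) : ∃ P : EuclideanSpace ℝ (Fin d) →L[ℝ] EuclideanSpace ℝ (Fin k),
      ∀ u ∈ E x, ∀ v ∈ F x, P (u + v : TangentSpace (𝓡 d) x) = 0 → v = 0 := by
  obtain ⟨N', hN', s', -, hsF⟩ := hS.continuous_right x hx
  obtain ⟨hli, hspan⟩ := hsF x ⟨mem_of_mem_nhds hN', hx⟩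
  have hrank : Module.finrank ℝ (F x) = k := by
    rw [← hspan, finrank_span_eq_card hli, Fintype.card_fin]
  have : FiniteDimensional ℝ (TangentSpace (𝓡 d) x) :=
    inferInstanceAs (FiniteDimensional ℝ (EuclideanSpace ℝ (Fin d)))
  have e : F x ≃ₗ[ℝ] EuclideanSpace ℝ (Fin k) :=
    LinearEquiv.ofFinrankEq _ _ (by rw [hrank, finrank_euclideanSpace_fin])
  let Q : EuclideanSpace ℝ (Fin d) →ₗ[ℝ] EuclideanSpace ℝ (Fin k) :=
    (e.toLinearMap ∘ₗ (F x).projectionOnto (E x) (hS.isCompl x hx).symm :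
      TangentSpace (𝓡 d) x →ₗ[ℝ] EuclideanSpace ℝ (Fin k))
  refine ⟨LinearMap.toContinuousLinearMap Q, fun u hu v hv h ↦ ?_⟩
  have h1 : e ((F x).projectionOnto (E x) (hS.isCompl x hx).symm (u + v)) = 0 := h
  rw [map_eq_zero_iff e e.injective, Submodule.projectionOnto_apply_eq_zero_iff] at h1
  exact Submodule.disjoint_def.1 (hS.isCompl x hx).disjoint v
    (by simpa using (E x).sub_mem h1 hu) hv

section Cone

lemma isContinuousRiemannianBundle_of_contMDiff {V H B V' : Type*} [NormedAddCommGroup V]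
    [NormedSpace ℝ V] [TopologicalSpace H] (I : ModelWithCorners ℝ V H) [TopologicalSpace B]
    [ChartedSpace H B] [NormedAddCommGroup V'] [NormedSpace ℝ V'] (n : ℕ∞ω) (Q : B → Type*)
    [TopologicalSpace (TotalSpace V' Q)] [∀ x, NormedAddCommGroup (Q x)]
    [∀ x, InnerProductSpace ℝ (Q x)] [FiberBundle V' Q] [VectorBundle ℝ V' Q]
    [h : IsContMDiffRiemannianBundle I n V' Q] : IsContinuousRiemannianBundle V' Q := by
  obtain ⟨b, hb, hb'⟩ := h.exists_contMDiff
  exact ⟨b, hb.continuous, hb'⟩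

variable [RiemannianBundle (fun x : M ↦ TangentSpace (𝓡 d) x)]
  [IsContinuousRiemannianBundle (EuclideanSpace ℝ (Fin d)) (fun x : M ↦ TangentSpace (𝓡 d) x)]

lemma tendsto_norm_of_tendsto_tangentBundle {l : Filter ι} {p : ι → M}
    {t : ∀ j, TangentSpace (𝓡 d) (p j)} {x : M} {θ : TangentSpace (𝓡 d) x}
    (h : Tendsto (fun j ↦ (⟨p j, t j⟩ : TangentBundle (𝓡 d) M)) l (𝓝 ⟨x, θ⟩)) :
    Tendsto (fun j ↦ ‖t j‖) l (𝓝 ‖θ‖) := by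
  have h1 : Continuous (fun w : TangentBundle (𝓡 d) M ↦ inner ℝ w.2 w.2) :=
    Continuous.inner_bundle (F := EuclideanSpace ℝ (Fin d))
      (E := fun x : M ↦ TangentSpace (𝓡 d) x) (b := fun w : TangentBundle (𝓡 d) M ↦ w.1)
      (v := fun w ↦ w.2) (w := fun w ↦ w.2) continuous_id continuous_id
  have h2 := (Real.continuous_sqrt.tendsto _).comp ((h1.tendsto ⟨x, θ⟩).comp h)
  rw [← norm_eq_sqrt_real_inner] at h2
  exact h2.congr fun j ↦ (norm_eq_sqrt_real_inner (t j)).symm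

/-- A limit of vectors in the open cones lies in the closed cone. -/
lemma IsContinuousSplittingOn.exists_of_tendsto_of_mem_cone
    (hS : IsContinuousSplittingOn E F m k W) (hW : IsOpen W) {a : ℝ} {l : Filter ι}
    [l.NeBot] {p : ι → M} {t : ∀ j, TangentSpace (𝓡 d) (p j)}
    (hp : ∀ᶠ j in l, t j ∈ cone E F a (p j)) {x : M} (hx : x ∈ W) {θ : TangentSpace (𝓡 d) x}
    (h : Tendsto (fun j ↦ (⟨p j, t j⟩ : TangentBundle (𝓡 d) M)) l (𝓝 ⟨x, θ⟩)) :
    ∃ u ∈ E x, ∃ v ∈ F x, θ = u + v ∧ ‖u‖ ≤ a * ‖v‖ := by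
  obtain ⟨u₀, hu₀, v₀, hv₀, rfl⟩ := Submodule.mem_sup.1
    (show θ ∈ E x ⊔ F x by rw [(hS.isCompl x hx).sup_eq_top]; trivial)
  have hdec : ∀ j, ∃ q : TangentSpace (𝓡 d) (p j) × TangentSpace (𝓡 d) (p j),
      t j ∈ cone E F a (p j) →
        q.1 ∈ E (p j) ∧ q.2 ∈ F (p j) ∧ t j = q.1 + q.2 ∧ ‖q.1‖ ≤ a * ‖q.2‖ := by
    intro j
    by_cases hj : t j ∈ cone E F a (p j)
    · rcases hj with ⟨u, hu, v, hv, h1, h2⟩ | h0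
      · exact ⟨(u, v), fun _ ↦ ⟨hu, hv, h1, h2.le⟩⟩
      · refine ⟨(0, 0), fun _ ↦ ⟨zero_mem _, zero_mem _, ?_, by simp⟩⟩
        simpa using h0
    · exact ⟨0, fun h ↦ absurd h hj⟩
  choose q hq using hdec
  have h' : Tendsto (fun j ↦ (⟨p j, (q j).1 + (q j).2⟩ : TangentBundle (𝓡 d) M)) l
      (𝓝 ⟨x, u₀ + v₀⟩) := by
    refine h.congr' ?_
    filter_upwards [hp] with j hj
    rw [(hq j hj).2.2.1]
  obtain ⟨h1, h2⟩ := hS.tendsto_components hW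
    (hp.mono fun j hj ↦ ⟨(hq j hj).1, (hq j hj).2.1⟩) hx hu₀ hv₀ h'
  refine ⟨u₀, hu₀, v₀, hv₀, rfl, le_of_tendsto_of_tendsto
    (tendsto_norm_of_tendsto_tangentBundle h1)
    ((tendsto_norm_of_tendsto_tangentBundle h2).const_mul a) ?_⟩
  exact hp.mono fun j hj ↦ (hq j hj).2.2.2

/-- Vectors converging to a nonzero vector of the open cone are eventually in the open cones. -/
lemma IsContinuousSplittingOn.eventually_mem_cone
    (hS : IsContinuousSplittingOn E F m k W) (hW : IsOpen W) {a : ℝ} {l : Filter ι} [l.NeBot]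
    {p : ι → M} {t : ∀ j, TangentSpace (𝓡 d) (p j)} {x : M} (hx : x ∈ W)
    {u₀ v₀ : TangentSpace (𝓡 d) x} (hu₀ : u₀ ∈ E x) (hv₀ : v₀ ∈ F x) (huv : ‖u₀‖ < a * ‖v₀‖)
    (h : Tendsto (fun j ↦ (⟨p j, t j⟩ : TangentBundle (𝓡 d) M)) l (𝓝 ⟨x, u₀ + v₀⟩)) :
    ∀ᶠ j in l, t j ∈ cone E F a (p j) := by
  have hpW : ∀ᶠ j in l, p j ∈ W := (tendsto_tangentBundle_iff.1 h).1 (hW.mem_nhds hx)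
  have hdec : ∀ j, ∃ q : TangentSpace (𝓡 d) (p j) × TangentSpace (𝓡 d) (p j),
      p j ∈ W → q.1 ∈ E (p j) ∧ q.2 ∈ F (p j) ∧ t j = q.1 + q.2 := by
    intro j
    by_cases hj : p j ∈ W
    · obtain ⟨u, hu, v, hv, huv⟩ := Submodule.mem_sup.1
        (show t j ∈ E (p j) ⊔ F (p j) by rw [(hS.isCompl _ hj).sup_eq_top]; trivial)
      exact ⟨(u, v), fun _ ↦ ⟨hu, hv, huv.symm⟩⟩
    · exact ⟨0, fun h ↦ absurd h hj⟩
  choose q hq using hdec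
  have h' : Tendsto (fun j ↦ (⟨p j, (q j).1 + (q j).2⟩ : TangentBundle (𝓡 d) M)) l
      (𝓝 ⟨x, u₀ + v₀⟩) := by
    refine h.congr' ?_
    filter_upwards [hpW] with j hj
    rw [(hq j hj).2.2]
  obtain ⟨h1, h2⟩ := hS.tendsto_components hW
    (hpW.mono fun j hj ↦ ⟨(hq j hj).1, (hq j hj).2.1⟩) hx hu₀ hv₀ h'
  filter_upwards [hpW, (tendsto_norm_of_tendsto_tangentBundle h1).eventually_lt
    ((tendsto_norm_of_tendsto_tangentBundle h2).const_mul a) huv] with j hj hlt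
  exact Or.inl ⟨_, (hq j hj).1, _, (hq j hj).2.1, (hq j hj).2.2, hlt⟩

end Cone

end Splitting

/-! ### Charts and the Riemannian distance -/

section ChartDistance
open Metric

variable {E : Type*} [NormedAddCommGroup E] [NormedSpace ℝ E] {H : Type*} [TopologicalSpace H]
  (I : ModelWithCorners ℝ E H) {M : Type*} [PseudoEMetricSpace M] [ChartedSpace H M]
  [RiemannianBundle (fun x : M ↦ TangentSpace I x)] [IsManifold I 1 M]
  [IsContinuousRiemannianBundle E (fun x : M ↦ TangentSpace I x)]

/-- The inverse of a chart has bounded derivative near the base point. -/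
lemma eventually_enorm_mfderivWithin_extChartAt_symm_le (x : M) :
    ∃ C : NNReal, ∀ᶠ y in 𝓝[range I] (extChartAt I x x), ∀ w : E,
      ‖(mfderivWithin 𝓘(ℝ, E) I (extChartAt I x).symm (range I) y w :
        TangentSpace I ((extChartAt I x).symm y))‖ₑ ≤ C * ‖w‖ₑ := by
  rcases eventually_norm_symmL_trivializationAt_lt E (fun x : M ↦ TangentSpace I x) x
    with ⟨C, C_pos, hC⟩
  lift C to NNReal using C_pos.le
  refine ⟨C, ?_⟩
  have h1 : ∀ᶠ y in 𝓝 x, ∀ w : E,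
      ‖(mfderivWithin 𝓘(ℝ, E) I (extChartAt I x).symm (range I) (extChartAt I x y) w :
        TangentSpace I ((extChartAt I x).symm (extChartAt I x y)))‖ₑ ≤ C * ‖w‖ₑ := by
    filter_upwards [hC, chart_source_mem_nhds H x] with y hy h'y w
    have h2 : ‖(trivializationAt E (fun x : M ↦ TangentSpace I x) x).symmL ℝ y w‖ ≤ C * ‖w‖ :=
      ContinuousLinearMap.le_of_opNorm_le _ hy.le w
    rw [TangentBundle.symmL_trivializationAt h'y] at h2
    have A : (extChartAt I x).symm (extChartAt I x y) = y :=
      (extChartAt I x).left_inv (by simpa using h'y)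
    have key : ∀ (y' : M) (_ : y' = y) (w' : E),
        enorm (E := TangentSpace I y') w' = enorm (E := TangentSpace I y) w' := by
      rintro _ rfl _
      rfl
    refine (key _ A _).trans_le ?_
    have h3 := ENNReal.ofReal_le_ofReal h2
    rw [ENNReal.ofReal_mul C.coe_nonneg, ENNReal.ofReal_coe_nnreal, ofReal_norm,
      ofReal_norm] at h3
    exact h3
  have h2 : 𝓝 x = 𝓝 ((extChartAt I x).symm (extChartAt I x x)) := by simp
  rw [h2] at h1
  have h3 : ContinuousAt (extChartAt I x).symm (extChartAt I x x) := continuousAt_extChartAt_symm _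
  filter_upwards [nhdsWithin_le_nhds (h3.preimage_mem_nhds h1),
    extChartAt_target_mem_nhdsWithin x] with y hy h'y
  have h4 : extChartAt I x ((extChartAt I x).symm y) = y := (extChartAt I x).right_inv h'y
  have h5 := mem_preimage.1 hy
  simp only [mem_ofPred_eq] at h5
  rwa [h4] at h5

variable [IsRiemannianManifold I M]

/-- Near any point the Riemannian distance is bounded by a multiple of the distance in the chart. -/
lemma eventually_edist_le_edist_extChartAt (x : M) :
    ∃ C : NNReal, ∀ᶠ q : M × M in 𝓝 (x, x),
      edist q.1 q.2 ≤ C * edist (extChartAt I x q.1) (extChartAt I x q.2) := by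
  obtain ⟨C, hC⟩ := eventually_enorm_mfderivWithin_extChartAt_symm_le I x
  refine ⟨C, ?_⟩
  obtain ⟨r, r_pos, hr⟩ : ∃ r > 0,
      ball (extChartAt I x x) r ∩ range I ⊆ (extChartAt I x).target ∩
        {y | ∀ w : E,
          ‖(mfderivWithin 𝓘(ℝ, E) I (extChartAt I x).symm (range I) y w :
            TangentSpace I ((extChartAt I x).symm y))‖ₑ ≤ C * ‖w‖ₑ} :=
    mem_nhdsWithin_iff.1 (inter_mem (extChartAt_target_mem_nhdsWithin x) hC)
  have A : (extChartAt I x) ⁻¹' (ball (extChartAt I x x) r ∩ range I) ∈ 𝓝 x := by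
    apply extChartAt_preimage_mem_nhds_of_mem_nhdsWithin (by simp)
    rw [inter_comm]
    exact inter_mem_nhdsWithin _ (ball_mem_nhds _ r_pos)
  have A' := inter_mem A (chart_source_mem_nhds H x)
  rw [nhds_prod_eq]
  filter_upwards [prod_mem_prod A' A'] with ⟨z, y⟩ ⟨⟨hz, h'z⟩, hy, h'y⟩
  dsimp only at hz h'z hy h'y ⊢
  let η := ContinuousAffineMap.lineMap (R := ℝ) (extChartAt I x z) (extChartAt I x y)
  set γ := (extChartAt I x).symm ∘ η
  have hη : Icc 0 1 ⊆ ⇑η ⁻¹' ((extChartAt I x).target ∩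
        {y | ∀ w : E,
          ‖(mfderivWithin 𝓘(ℝ, E) I (extChartAt I x).symm (range I) y w :
            TangentSpace I ((extChartAt I x).symm y))‖ₑ ≤ C * ‖w‖ₑ}) := by
    simp only [← image_subset_iff, ContinuousAffineMap.coe_lineMap_eq,
     ← segment_eq_image_lineMap, η]
    apply Subset.trans _ hr
    exact ((convex_ball _ _).inter I.convex_range).segment_subset hz hy
  simp only [preimage_inter, subset_inter_iff] at hη
  have η_smooth : CMDiff[Icc 0 1] 1 η := by
    apply ContMDiff.contMDiffOn
    rw [contMDiff_iff_contDiff]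
    exact ContinuousAffineMap.contDiff _
  have : riemannianEDist I z y ≤ pathELength I γ 0 1 := by
    apply riemannianEDist_le_pathELength _ _ _ zero_le_one
    · exact (contMDiffOn_extChartAt_symm x).comp η_smooth hη.1
    · simp [γ, η, ContinuousAffineMap.coe_lineMap_eq, h'z]
    · simp [γ, η, ContinuousAffineMap.coe_lineMap_eq, h'y]
  rw [IsRiemannianManifold.out (I := I) z y]
  apply this.trans
  rw [← lintegral_fderiv_lineMap_eq_edist, pathELength_eq_lintegral_mfderivWithin_Icc,
    ← lintegral_const_mul' _ _ ENNReal.coe_ne_top]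
  apply setLIntegral_mono' measurableSet_Icc (fun t ht ↦ ?_)
  have h1 : mfderivWithin 𝓘(ℝ, ℝ) I γ (Icc 0 1) t =
      (mfderivWithin 𝓘(ℝ, E) I (extChartAt I x).symm (range I) (η t)) ∘L
        (mfderivWithin 𝓘(ℝ, ℝ) 𝓘(ℝ, E) η (Icc 0 1) t) := by
    apply mfderivWithin_comp
    · exact mdifferentiableWithinAt_extChartAt_symm (hη.1 ht)
    · exact η_smooth.mdifferentiableOn one_ne_zero t ht
    · exact hη.1.trans (preimage_mono (extChartAt_target_subset_range x))
    · rw [uniqueMDiffWithinAt_iff_uniqueDiffWithinAt]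
      exact uniqueDiffOn_Icc zero_lt_one t ht
  rw [h1]
  refine (hη.2 ht (mfderivWithin 𝓘(ℝ, ℝ) 𝓘(ℝ, E) η (Icc 0 1) t 1)).trans ?_
  simp only [mfderivWithin_eq_fderivWithin]
  exact le_of_eq rfl

end ChartDistance

/-! ### Pairs of points in cone position -/

section ConePair

variable {ι : Type*} {d : ℕ} {M : Type*}

lemma eventually_of_forall_ultrafilter {α : Type*} {l : Filter α} {p : α → Prop}
    (h : ∀ u : Ultrafilter α, (u : Filter α) ≤ l → (∀ᶠ x in (u : Filter α), ¬ p x) → False) :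
    ∀ᶠ x in l, p x := by
  by_contra hp
  have hne : (l ⊓ 𝓟 {x | ¬ p x}).NeBot := frequently_iff_neBot.1 (not_eventually.1 hp)
  have hle := Ultrafilter.of_le (l ⊓ 𝓟 {x | ¬ p x})
  exact h (Ultrafilter.of _) (hle.trans inf_le_left)
    (le_principal_iff.1 (hle.trans inf_le_right))

/-- On a compact manifold one can select, for each point `y`, one of finitely many charts around
`y`, in such a way that near each point `x` only charts around `x` are selected. -/
lemma exists_chart_selection (d : ℕ) (M : Type*) [EMetricSpace M] [CompactSpace M]
    [ChartedSpace (EuclideanSpace ℝ (Fin d)) M] :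
    ∃ (s : Finset M) (σ : M → M), (∀ y, σ y ∈ s) ∧
      ∀ x, ∀ᶠ y in 𝓝 x, x ∈ (extChartAt (𝓡 d) (σ y)).source := by
  have hK : ∀ i : M, ∃ K ∈ 𝓝 i, IsClosed K ∧ K ⊆ (extChartAt (𝓡 d) i).source := fun i ↦
    exists_mem_nhds_isClosed_subset (extChartAt_source_mem_nhds (I := 𝓡 d) i)
  choose K hKn hKc hKs using hK
  obtain ⟨s, -, hs⟩ := isCompact_univ.elim_nhds_subcover K fun i _ ↦ hKn i
  have hσ : ∀ y, ∃ i ∈ s, y ∈ K i := fun y ↦ by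
    simpa using hs (mem_univ y)
  choose σ hσs hσK using hσ
  refine ⟨s, σ, hσs, fun x ↦ ?_⟩
  have h1 : ∀ᶠ y in 𝓝 x, ∀ i ∈ s, x ∉ K i → y ∉ K i := by
    refine (Finset.eventually_all s).2 fun i _ ↦ ?_
    by_cases hx : x ∈ K i
    · exact Eventually.of_forall fun y h ↦ absurd hx h
    · filter_upwards [(hKc i).isOpen_compl.mem_nhds hx] with y hy _
      exact hy
  filter_upwards [h1] with y hy
  by_contra hx
  exact hy _ (hσs y) (fun h ↦ hx (hKs _ h)) (hσK y)

variable [EMetricSpace M] [ChartedSpace (EuclideanSpace ℝ (Fin d)) M] [IsManifold (𝓡 d) 1 M]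
  {s : Finset M} {σ : M → M}

lemma HasDirection.tendsto_chartDiff_selection (hσs : ∀ y, σ y ∈ s)
    (hσ : ∀ x, ∀ᶠ y in 𝓝 x, x ∈ (extChartAt (𝓡 d) (σ y)).source) {l : Filter ι} {y z : ι → M}
    {r : ι → ℝ} {x : M} {θ : EuclideanSpace ℝ (Fin d)} (h : HasDirection l y z r x θ) :
    Tendsto (fun j ↦ (⟨y j, (r j)⁻¹ • chartDiff (σ (y j)) (y j) (z j)⟩ : TangentBundle (𝓡 d) M)) l
      (𝓝 ⟨x, θ⟩) := by
  intro U hU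
  have h1 : ∀ᶠ j in l, ∀ i ∈ s, x ∈ (extChartAt (𝓡 d) i).source →
      (⟨y j, (r j)⁻¹ • chartDiff i (y j) (z j)⟩ : TangentBundle (𝓡 d) M) ∈ U := by
    refine (Finset.eventually_all s).2 fun i _ ↦ ?_
    by_cases hx : x ∈ (extChartAt (𝓡 d) i).source
    · filter_upwards [h.tendsto_chartDiff hx hU] with j hj _
      exact hj
    · exact Eventually.of_forall fun j h ↦ absurd h hx
  have h2 : ∀ᶠ j in l, x ∈ (extChartAt (𝓡 d) (σ (y j))).source := h.tendsto_left (hσ x)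
  change ∀ᶠ j in l, _
  filter_upwards [h1, h2] with j h1 h2
  exact h1 _ (hσs _) h2

variable [RiemannianBundle (fun x : M ↦ TangentSpace (𝓡 d) x)]
  {E F : (x : M) → Submodule ℝ (TangentSpace (𝓡 d) x)} {m k : ℕ} {W : Set M} {a : ℝ}

/-- The vector from `y` to `z`, read in the selected chart at `y`, lies in the cone of width `a`
around `F y`. -/
def IsConePair (E F : (x : M) → Submodule ℝ (TangentSpace (𝓡 d) x)) (a : ℝ) (σ : M → M)
    (y z : M) : Prop :=
  chartDiff (σ y) y z ∈ cone E F a y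

lemma isConePair_self (y : M) : IsConePair E F a σ y y := by
  refine Or.inr ?_
  simp only [chartDiff, sub_self]
  exact map_zero (tangentCoordChange (𝓡 d) (σ y) y y)

variable [IsContinuousRiemannianBundle (EuclideanSpace ℝ (Fin d))
  (fun x : M ↦ TangentSpace (𝓡 d) x)]

/-- Pairs whose direction is in the open cone are eventually in cone position. -/
lemma HasDirection.eventually_isConePair (hσs : ∀ y, σ y ∈ s)
    (hσ : ∀ x, ∀ᶠ y in 𝓝 x, x ∈ (extChartAt (𝓡 d) (σ y)).source)
    (hS : IsContinuousSplittingOn E F m k W) (hW : IsOpen W) {l : Filter ι} [l.NeBot] {y z : ι → M}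
    {r : ι → ℝ} (hr : ∀ᶠ j in l, 0 < r j) {x : M} (hx : x ∈ W) {θ : TangentSpace (𝓡 d) x}
    (h : HasDirection l y z r x θ) {u v : TangentSpace (𝓡 d) x} (hu : u ∈ E x) (hv : v ∈ F x)
    (hθ : θ = u + v) (huv : ‖u‖ < a * ‖v‖) : ∀ᶠ j in l, IsConePair E F a σ (y j) (z j) := by
  have h1 := h.tendsto_chartDiff_selection hσs hσ
  subst hθ
  filter_upwards [hS.eventually_mem_cone hW hx hu hv huv h1, hr] with j hj hrj
  exact (smul_mem_cone_iff (inv_pos.2 hrj)).1 hj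

/-- The direction of pairs in cone position lies in the closed cone. -/
lemma HasDirection.exists_of_isConePair (hσs : ∀ y, σ y ∈ s)
    (hσ : ∀ x, ∀ᶠ y in 𝓝 x, x ∈ (extChartAt (𝓡 d) (σ y)).source)
    (hS : IsContinuousSplittingOn E F m k W) (hW : IsOpen W) {l : Filter ι} [l.NeBot] {y z : ι → M}
    {r : ι → ℝ} (hr : ∀ᶠ j in l, 0 < r j) {x : M} (hx : x ∈ W) {θ : TangentSpace (𝓡 d) x}
    (h : HasDirection l y z r x θ) (hc : ∀ᶠ j in l, IsConePair E F a σ (y j) (z j)) :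
    ∃ u ∈ E x, ∃ v ∈ F x, θ = u + v ∧ ‖u‖ ≤ a * ‖v‖ := by
  refine hS.exists_of_tendsto_of_mem_cone hW ?_ hx (h.tendsto_chartDiff_selection hσs hσ)
  filter_upwards [hc, hr] with j hj hrj
  exact smul_mem_cone (inv_pos.2 hrj) hj

/-- A map whose derivative at `x` sends the closed cone into the open cone preserves cone position
of pairs near `x`. -/
lemma eventually_isConePair_map (hσs : ∀ y, σ y ∈ s)
    (hσ : ∀ x, ∀ᶠ y in 𝓝 x, x ∈ (extChartAt (𝓡 d) (σ y)).source)
    (hS : IsContinuousSplittingOn E F m k W) (hW : IsOpen W) {G : M → M} {x : M} (hx : x ∈ W)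
    (hGx : G x ∈ W) (hG : ContMDiffAt (𝓡 d) (𝓡 d) 1 G x)
    (hcone : ∀ u ∈ E x, ∀ v ∈ F x, ‖u‖ ≤ a * ‖v‖ → u + v ≠ 0 → ∃ u' ∈ E (G x), ∃ v' ∈ F (G x),
      mfderiv (𝓡 d) (𝓡 d) G x (u + v) = u' + v' ∧ ‖u'‖ < a * ‖v'‖) :
    ∀ᶠ q : M × M in 𝓝 (x, x),
      IsConePair E F a σ q.1 q.2 → IsConePair E F a σ (G q.1) (G q.2) := by
  refine eventually_of_forall_ultrafilter fun l hl hn ↦ ?_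
  have h1 : Tendsto Prod.fst (l : Filter (M × M)) (𝓝 x) :=
    (continuous_fst.tendsto (x, x)).mono_left hl
  have h2 : Tendsto Prod.snd (l : Filter (M × M)) (𝓝 x) :=
    (continuous_snd.tendsto (x, x)).mono_left hl
  have hne : ∀ᶠ q : M × M in (l : Filter (M × M)), q.1 ≠ q.2 := by
    filter_upwards [hn] with q hq heq
    rw [heq] at hq
    exact hq fun _ ↦ isConePair_self _
  obtain ⟨hr, θ, hθ0, hθ⟩ := exists_hasDirection (d := d) h1 h2 hne
  obtain ⟨u, hu, v, hv, huv, hle⟩ := hθ.exists_of_isConePair hσs hσ hS hW hr hx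
    (hn.mono fun q hq ↦ (Classical.not_imp.1 hq).1)
  obtain ⟨u', hu', v', hv', huv', hlt⟩ := hcone u hu v hv hle (huv ▸ hθ0)
  rw [← huv] at huv'
  have h3 := (hθ.map hG).eventually_isConePair hσs hσ hS hW hr hGx hu' hv' huv' hlt
  obtain ⟨q, hq, hq'⟩ := (h3.and hn).exists
  exact hq' fun _ ↦ hq

/-- Near `x`, pairs in cone position are separated by a linear projection to `ℝᵏ`. -/
lemma eventually_norm_sub_le_of_isConePair (hσs : ∀ y, σ y ∈ s)
    (hσ : ∀ x, ∀ᶠ y in 𝓝 x, x ∈ (extChartAt (𝓡 d) (σ y)).source)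
    (hS : IsContinuousSplittingOn E F m k W) (hW : IsOpen W) {x : M} (hx : x ∈ W) :
    ∃ (P : EuclideanSpace ℝ (Fin d) →L[ℝ] EuclideanSpace ℝ (Fin k)) (K : ℝ), 0 < K ∧
      ∀ᶠ q : M × M in 𝓝 (x, x), IsConePair E F a σ q.1 q.2 →
        ‖extChartAt (𝓡 d) x q.2 - extChartAt (𝓡 d) x q.1‖ ≤
          K * ‖P (extChartAt (𝓡 d) x q.2) - P (extChartAt (𝓡 d) x q.1)‖ := by
  obtain ⟨P, hP⟩ := hS.exists_clm_ker hx
  refine ⟨P, ?_⟩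
  -- letting the constant tend to infinity together with the pairs yields a uniform constant
  have key : ∀ᶠ w : ℝ × (M × M) in atTop ×ˢ 𝓝 (x, x), IsConePair E F a σ w.2.1 w.2.2 →
      ‖extChartAt (𝓡 d) x w.2.2 - extChartAt (𝓡 d) x w.2.1‖ ≤
        w.1 * ‖P (extChartAt (𝓡 d) x w.2.2) - P (extChartAt (𝓡 d) x w.2.1)‖ := by
    refine eventually_of_forall_ultrafilter fun l hl hn ↦ ?_
    have h0 : Tendsto Prod.fst (l : Filter (ℝ × (M × M))) atTop := tendsto_fst.mono_left hl
    have h12 : Tendsto Prod.snd (l : Filter (ℝ × (M × M))) (𝓝 (x, x)) := tendsto_snd.mono_left hl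
    have h1 : Tendsto (fun w ↦ w.2.1) (l : Filter (ℝ × (M × M))) (𝓝 x) :=
      (continuous_fst.tendsto (x, x)).comp h12
    have h2 : Tendsto (fun w ↦ w.2.2) (l : Filter (ℝ × (M × M))) (𝓝 x) :=
      (continuous_snd.tendsto (x, x)).comp h12
    have hne : ∀ᶠ w in (l : Filter (ℝ × (M × M))), w.2.1 ≠ w.2.2 := by
      filter_upwards [hn] with w hw heq
      rw [heq] at hw
      exact hw fun _ ↦ by simp
    obtain ⟨hr, θ, hθ0, hθ⟩ := exists_hasDirection (d := d) h1 h2 hne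
    obtain ⟨u, hu, v, hv, huv, hle⟩ := hθ.exists_of_isConePair hσs hσ hS hW hr hx
      (hn.mono fun q hq ↦ (Classical.not_imp.1 hq).1)
    -- the direction is not in the kernel of `P`, since the closed cone meets `E x` only at `0`
    have hPθ : P θ = 0 := by
      have h3 := ((P.continuous.tendsto θ).comp hθ.tendsto_diff).norm
      have h4 : Tendsto (fun w : ℝ × (M × M) ↦ w.1⁻¹) (l : Filter (ℝ × (M × M))) (𝓝 0) :=
        tendsto_inv_atTop_zero.comp h0
      refine norm_le_zero_iff.1 (le_of_tendsto_of_tendsto h3 h4 ?_)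
      filter_upwards [hn, hr, h0 (Ioi_mem_atTop 0)] with w hw hrw hw0
      have hw0' : 0 < w.1 := hw0
      have h5 := not_le.1 (Classical.not_imp.1 hw).2
      simp only [Function.comp_apply] at hrw ⊢
      rw [map_smul, norm_smul, map_sub, norm_inv, norm_norm, inv_mul_le_iff₀ hrw,
        ← div_eq_mul_inv, le_div_iff₀ hw0', mul_comm]
      exact h5.le
    have hv0 : v = 0 := hP u hu v hv (by rw [← huv]; exact hPθ)
    rw [hv0, norm_zero, mul_zero] at hle
    have hu0 : u = 0 := norm_le_zero_iff.1 hle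
    refine hθ0 (huv.trans ?_)
    rw [hu0, hv0, add_zero]
    rfl
  obtain ⟨p₁, hp₁, p₂, hp₂, h⟩ := Filter.eventually_prod_iff.1 key
  obtain ⟨K, hK, hK0⟩ := (hp₁.and (eventually_gt_atTop 0)).exists
  exact ⟨K, hK0, hp₂.mono fun q hq ↦ h hK hq⟩

end ConePair

/-! ### Volume of sets in cone position -/

section Volume

/-- If distances of `f` are controlled by distances of `ψ` on `A`, then so are the volumes of the
images. -/
lemma euclideanHausdorffMeasure_image_le {X Y Z : Type*} [EMetricSpace Y] [MeasurableSpace Y]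
    [BorelSpace Y] [EMetricSpace Z] [MeasurableSpace Z] [BorelSpace Z] {f : X → Y} {ψ : X → Z}
    {A : Set X} {C : NNReal} (h : ∀ y ∈ A, ∀ z ∈ A, edist (f y) (f z) ≤ C * edist (ψ y) (ψ z))
    (k : ℕ) : μHE[k] (f '' A) ≤ (C : ENNReal) ^ k * μHE[k] (ψ '' A) := by
  rcases A.eq_empty_or_nonempty with rfl | ⟨x₀, hx₀⟩
  · simp
  have : Nonempty X := ⟨x₀⟩
  have hinv : ∀ w ∈ ψ '' A, Function.invFunOn ψ A w ∈ A ∧ ψ (Function.invFunOn ψ A w) = w :=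
    fun w hw ↦ ⟨Function.invFunOn_mem hw, Function.invFunOn_eq hw⟩
  have hlip : LipschitzOnWith C (fun w ↦ f (Function.invFunOn ψ A w)) (ψ '' A) := by
    intro w hw w' hw'
    have := h _ (hinv w hw).1 _ (hinv w' hw').1
    rwa [(hinv w hw).2, (hinv w' hw').2] at this
  have himg : (fun w ↦ f (Function.invFunOn ψ A w)) '' (ψ '' A) = f '' A := by
    rw [image_image]
    refine image_congr fun y hy ↦ ?_
    have h1 := hinv (ψ y) (mem_image_of_mem ψ hy)
    have h2 := h _ h1.1 y hy
    rw [h1.2, edist_self, mul_zero, nonpos_iff_eq_zero, edist_eq_zero] at h2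
    exact h2
  have h1 := hlip.hausdorffMeasure_image_le (d := (k : ℝ)) (Nat.cast_nonneg k)
  rw [himg, ENNReal.rpow_natCast] at h1
  simp only [Measure.euclideanHausdorffMeasure_def, Measure.smul_apply, ENNReal.smul_def,
    smul_eq_mul]
  rw [mul_left_comm]
  gcongr

lemma euclideanHausdorffMeasure_lt_top {k : ℕ} {B : Set (EuclideanSpace ℝ (Fin k))}
    (hB : Bornology.IsBounded B) : μHE[k] B < ⊤ := by
  have h := isAddHaarMeasure_euclideanHausdorffMeasure (E := EuclideanSpace ℝ (Fin k))
  rw [finrank_euclideanSpace_fin] at h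
  exact hB.measure_lt_top

variable {d : ℕ} {M : Type*} [EMetricSpace M] [ChartedSpace (EuclideanSpace ℝ (Fin d)) M]
  [IsManifold (𝓡 d) 1 M] [RiemannianBundle (fun x : M ↦ TangentSpace (𝓡 d) x)]
  [IsContinuousRiemannianBundle (EuclideanSpace ℝ (Fin d)) (fun x : M ↦ TangentSpace (𝓡 d) x)]
  [IsRiemannianManifold (𝓡 d) M] [MeasurableSpace M] [BorelSpace M]
  {E F : (x : M) → Submodule ℝ (TangentSpace (𝓡 d) x)} {m k : ℕ} {W : Set M} {a : ℝ}
  {s : Finset M} {σ : M → M}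

/-- Near `x`, a set whose pairs of points are in cone position is a Lipschitz graph over a bounded
subset of `ℝᵏ`. Hence its volume is bounded, and so is the volume of its image under a `C¹` map. -/
lemma exists_measure_image_le_of_isConePair (hσs : ∀ y, σ y ∈ s)
    (hσ : ∀ x, ∀ᶠ y in 𝓝 x, x ∈ (extChartAt (𝓡 d) (σ y)).source)
    (hS : IsContinuousSplittingOn E F m k W) (hW : IsOpen W) {x : M} (hx : x ∈ W) {G : M → M}
    (hG : ContMDiffAt (𝓡 d) (𝓡 d) 1 G x) :
    ∃ N ∈ 𝓝 x, ∃ C : ENNReal, C ≠ ⊤ ∧ ∀ A ⊆ N,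
      (∀ y ∈ A, ∀ z ∈ A, IsConePair E F a σ y z) → μHE[k] (G '' A) ≤ C := by
  obtain ⟨P, K, hK, hP⟩ := eventually_norm_sub_le_of_isConePair (a := a) hσs hσ hS hW hx
  obtain ⟨K', hK', hKG⟩ := exists_eventually_norm_extChartAt_map_sub_le hG
  obtain ⟨C, hC⟩ := eventually_edist_le_edist_extChartAt (𝓡 d) (G x)
  have hGG : Tendsto (fun q : M × M ↦ (G q.1, G q.2)) (𝓝 (x, x)) (𝓝 (G x, G x)) :=
    (hG.continuousAt.tendsto.comp (continuous_fst.tendsto (x, x))).prodMk_nhds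
      (hG.continuousAt.tendsto.comp (continuous_snd.tendsto (x, x)))
  have hall := hP.and (hKG.and (hGG.eventually hC))
  rw [nhds_prod_eq] at hall
  obtain ⟨N, hN, hNall⟩ := mem_prod_self_iff.1 hall
  have hN' := (continuousAt_extChartAt (I := 𝓡 d) x) (Metric.ball_mem_nhds _ zero_lt_one)
  let B : Set (EuclideanSpace ℝ (Fin k)) := P '' Metric.ball (extChartAt (𝓡 d) x x) 1
  have hB : Bornology.IsBounded B := P.lipschitz.isBounded_image Metric.isBounded_ball
  refine ⟨N ∩ _, inter_mem hN hN', _, (ENNReal.mul_lt_top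
    (ENNReal.pow_lt_top (ENNReal.coe_lt_top (r := C * (K' * K).toNNReal)) (n := k))
    (euclideanHausdorffMeasure_lt_top hB)).ne, fun A hA hcone ↦ ?_⟩
  refine (euclideanHausdorffMeasure_image_le (ψ := fun y ↦ P (extChartAt (𝓡 d) x y))
    (C := C * (K' * K).toNNReal) (fun y hy z hz ↦ ?_) k).trans ?_
  · obtain ⟨h1, h2, h3⟩ := hNall (mk_mem_prod (hA hy).1 (hA hz).1)
    have h4 := h2.trans (mul_le_mul_of_nonneg_left (h1 (hcone y hy z hz)) hK'.le)
    dsimp only at h3 h4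
    refine h3.trans ?_
    rw [ENNReal.coe_mul, mul_assoc]
    gcongr
    rw [edist_comm, edist_comm (P _), edist_dist, edist_dist, dist_eq_norm, dist_eq_norm]
    rw [← mul_assoc] at h4
    refine (ENNReal.ofReal_le_ofReal h4).trans_eq ?_
    rw [ENNReal.ofReal_mul (mul_pos hK' hK).le]
    rfl
  · gcongr
    rintro _ ⟨y, hy, rfl⟩
    exact ⟨_, (hA hy).2, rfl⟩

end Volume

/-! ### Disks tangent to the cone field -/

section Disk

/-- A function which is `C¹` on a convex set with nonempty interior has a first order expansion
there, uniformly in pairs of points. -/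
lemma isLittleO_sub_of_contDiffWithinAt {V V' : Type*} [NormedAddCommGroup V] [NormedSpace ℝ V]
    [NormedAddCommGroup V'] [NormedSpace ℝ V'] {f : V → V'} {B : Set V} (hB : Convex ℝ B)
    (hB' : (interior B).Nonempty) {p : V} (hp : p ∈ B) (hf : ContDiffWithinAt ℝ 1 f B p) :
    (fun q : V × V ↦ f q.2 - f q.1 - fderivWithin ℝ f B p (q.2 - q.1))
      =o[𝓝[B] p ×ˢ 𝓝[B] p] fun q ↦ q.2 - q.1 := by
  have hu : UniqueDiffOn ℝ B := uniqueDiffOn_convex hB hB'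
  have hcont : ContinuousWithinAt (fderivWithin ℝ f B) B p :=
    (hf.fderivWithin_right (m := 0) hu (by simp) hp).continuousWithinAt
  have hdiff : ∀ᶠ y in 𝓝[B] p, DifferentiableWithinAt ℝ f B y := by
    have h1 := hf.eventually (by simp)
    rw [insert_eq_of_mem hp] at h1
    exact h1.mono fun y hy ↦ hy.differentiableWithinAt one_ne_zero
  rw [Asymptotics.isLittleO_iff]
  intro c hc
  have hclose : ∀ᶠ y in 𝓝[B] p, ‖fderivWithin ℝ f B y - fderivWithin ℝ f B p‖ ≤ c := by
    filter_upwards [hcont (Metric.closedBall_mem_nhds _ hc)] with y hy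
    rwa [← dist_eq_norm]
  obtain ⟨ε, hε, hball⟩ := Metric.mem_nhdsWithin_iff.1 (hdiff.and hclose)
  have hN : Metric.ball p ε ∩ B ∈ 𝓝[B] p :=
    inter_mem (mem_nhdsWithin_of_mem_nhds (Metric.ball_mem_nhds p hε)) self_mem_nhdsWithin
  filter_upwards [prod_mem_prod hN hN] with q hq
  exact ((convex_ball p ε).inter hB).norm_image_sub_le_of_norm_hasFDerivWithin_le'
    (fun y hy ↦ (hball hy).1.hasFDerivWithinAt.mono inter_subset_right)
    (fun y hy ↦ (hball hy).2) hq.1 hq.2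

variable {ι : Type*} {d k : ℕ} {M : Type*}

section
variable [TopologicalSpace M] [ChartedSpace (EuclideanSpace ℝ (Fin d)) M]

lemma hasFDerivWithinAt_extChartAt_comp {φ : EuclideanSpace ℝ (Fin k) → M}
    {B : Set (EuclideanSpace ℝ (Fin k))} {p : EuclideanSpace ℝ (Fin k)}
    (hφ : MDifferentiableWithinAt (𝓡 k) (𝓡 d) φ B p) :
    ∃ A : EuclideanSpace ℝ (Fin k) →L[ℝ] EuclideanSpace ℝ (Fin d),
      (∀ w, A w = mfderivWithin (𝓡 k) (𝓡 d) φ B p w) ∧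
        HasFDerivWithinAt (extChartAt (𝓡 d) (φ p) ∘ φ) A B p := by
  let A : EuclideanSpace ℝ (Fin k) →L[ℝ] EuclideanSpace ℝ (Fin d) :=
    mfderivWithin (𝓡 k) (𝓡 d) φ B p
  have h1 : HasFDerivWithinAt (writtenInExtChartAt (𝓡 k) (𝓡 d) p φ) A
      ((extChartAt (𝓡 k) p).symm ⁻¹' B ∩ range (𝓡 k)) (extChartAt (𝓡 k) p p) :=
    hφ.hasMFDerivWithinAt.2
  have h2 : (extChartAt (𝓡 k) p).symm ⁻¹' B ∩ range (𝓡 k) = B := by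
    simp only [extChartAt_model_space_eq_id]
    simp
  have h3 : writtenInExtChartAt (𝓡 k) (𝓡 d) p φ = extChartAt (𝓡 d) (φ p) ∘ φ := by
    rw [writtenInExtChartAt, extChartAt_model_space_eq_id]
    rfl
  rw [h2, h3, extChartAt_model_space_eq_id] at h1
  exact ⟨A, fun _ ↦ rfl, h1⟩

/-- Pairs of points of a convex set have their directions transported by the derivative of a `C¹`
map on this set. -/
lemma HasDirection.of_contMDiffWithinAt [IsManifold (𝓡 d) 1 M] {φ : EuclideanSpace ℝ (Fin k) → M}
    {B : Set (EuclideanSpace ℝ (Fin k))} (hB : Convex ℝ B) (hB' : (interior B).Nonempty)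
    {p : EuclideanSpace ℝ (Fin k)} (hp : p ∈ B) (hφ : ContMDiffWithinAt (𝓡 k) (𝓡 d) 1 φ B p)
    {l : Filter ι} {y z : ι → EuclideanSpace ℝ (Fin k)} (hy : Tendsto y l (𝓝[B] p))
    (hz : Tendsto z l (𝓝[B] p)) {r : ι → ℝ} {η : EuclideanSpace ℝ (Fin k)}
    (hη : Tendsto (fun j ↦ (r j)⁻¹ • (z j - y j)) l (𝓝 η)) :
    HasDirection l (fun j ↦ φ (y j)) (fun j ↦ φ (z j)) r (φ p)
      (mfderivWithin (𝓡 k) (𝓡 d) φ B p η) := by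
  have hc := hφ.continuousWithinAt
  have hf : ContDiffWithinAt ℝ 1 (extChartAt (𝓡 d) (φ p) ∘ φ) B p :=
    contMDiffWithinAt_iff_contDiffWithinAt.1 (contMDiffWithinAt_iff_target.1 hφ).2
  have ho := (isLittleO_sub_of_contDiffWithinAt hB hB' hp hf).comp_tendsto (hy.prodMk hz)
  obtain ⟨A, hA, hfA⟩ :=
    hasFDerivWithinAt_extChartAt_comp (hφ.mdifferentiableWithinAt one_ne_zero)
  rw [hfA.fderivWithin (uniqueDiffOn_convex hB hB' p hp)] at ho
  have ho' : (fun j ↦ (extChartAt (𝓡 d) (φ p) ∘ φ) (z j) - (extChartAt (𝓡 d) (φ p) ∘ φ) (y j) -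
      A (z j - y j)) =o[l] fun j ↦ z j - y j := ho
  have h1 := tendsto_inv_smul_sub_of_isLittleO ho' hη
  refine ⟨hc.tendsto.comp hy, hc.tendsto.comp hz, ?_⟩
  rw [← hA η]
  exact h1

end

variable [EMetricSpace M] [ChartedSpace (EuclideanSpace ℝ (Fin d)) M]
  [IsManifold (𝓡 d) 1 M] [RiemannianBundle (fun x : M ↦ TangentSpace (𝓡 d) x)]
  [IsContinuousRiemannianBundle (EuclideanSpace ℝ (Fin d)) (fun x : M ↦ TangentSpace (𝓡 d) x)]
  {E F : (x : M) → Submodule ℝ (TangentSpace (𝓡 d) x)} {m : ℕ} {W : Set M} {a : ℝ}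
  {s : Finset M} {σ : M → M}

/-- Nearby points of a disk tangent to the cone field are in cone position. -/
lemma IsDiskTangentToCone.exists_forall_isConePair (hσs : ∀ y, σ y ∈ s)
    (hσ : ∀ x, ∀ᶠ y in 𝓝 x, x ∈ (extChartAt (𝓡 d) (σ y)).source)
    (hS : IsContinuousSplittingOn E F m k W) (hW : IsOpen W) {D : Set M}
    (hD : IsDiskTangentToCone E F k a D) (hDW : D ⊆ W) :
    ∃ ε : ENNReal, 0 < ε ∧ ∀ y ∈ D, ∀ z ∈ D, edist y z < ε → IsConePair E F a σ y z := by
  obtain ⟨φ, hφ, hinj, hder, hcone, rfl⟩ := hD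
  set B := Metric.closedBall (0 : EuclideanSpace ℝ (Fin k)) 1 with hBdef
  have hBconv : Convex ℝ B := convex_closedBall 0 1
  have hBint : (interior B).Nonempty :=
    ⟨0, Metric.ball_subset_interior_closedBall (Metric.mem_ball_self zero_lt_one)⟩
  by_contra! hcon
  have hex : ∀ n : ℕ, ∃ q : EuclideanSpace ℝ (Fin k) × EuclideanSpace ℝ (Fin k),
      q.1 ∈ B ∧ q.2 ∈ B ∧ edist (φ q.1) (φ q.2) < ((n : ENNReal) + 1)⁻¹ ∧
        ¬ IsConePair E F a σ (φ q.1) (φ q.2) := by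
    intro n
    obtain ⟨_, ⟨p, hp, rfl⟩, _, ⟨q, hq, rfl⟩, h1, h2⟩ := hcon ((n : ENNReal) + 1)⁻¹
      (ENNReal.inv_pos.2 (by finiteness))
    exact ⟨(p, q), hp, hq, h1, h2⟩
  -- bad pairs at distance tending to `0` accumulate at one point of the ball, as `φ` is injective
  choose q hq1 hq2 hqd hqn using hex
  let l : Ultrafilter ℕ := hyperfilter ℕ
  have hl : (l : Filter ℕ) ≤ atTop := Nat.hyperfilter_le_atTop
  have hBc : IsCompact B := isCompact_closedBall 0 1
  obtain ⟨p₁, hp₁, h1⟩ := hBc.ultrafilter_le_nhds (l.map fun n ↦ (q n).1)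
    (tendsto_principal.2 (Eventually.of_forall hq1))
  obtain ⟨p₂, hp₂, h2⟩ := hBc.ultrafilter_le_nhds (l.map fun n ↦ (q n).2)
    (tendsto_principal.2 (Eventually.of_forall hq2))
  have h1' : Tendsto (fun n ↦ (q n).1) (l : Filter ℕ) (𝓝[B] p₁) :=
    tendsto_nhdsWithin_iff.2 ⟨h1, Eventually.of_forall hq1⟩
  have h2' : Tendsto (fun n ↦ (q n).2) (l : Filter ℕ) (𝓝[B] p₂) :=
    tendsto_nhdsWithin_iff.2 ⟨h2, Eventually.of_forall hq2⟩
  have hφ1 := (hφ p₁ hp₁).continuousWithinAt.tendsto.comp h1'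
  have hφ2 := (hφ p₂ hp₂).continuousWithinAt.tendsto.comp h2'
  have heq : p₁ = p₂ := by
    refine hinj hp₁ hp₂ (edist_le_zero.1 ?_)
    refine le_of_tendsto_of_tendsto (hφ1.edist hφ2)
      ((ENNReal.tendsto_inv_nat_nhds_zero.comp (tendsto_add_atTop_nat 1)).mono_left hl) ?_
    filter_upwards with n
    simpa using (hqd n).le
  subst heq
  have hpos : ∀ n, 0 < ‖(q n).2 - (q n).1‖ := by
    intro n
    rw [norm_pos_iff, sub_ne_zero]
    intro h
    exact hqn n (by rw [h]; exact isConePair_self _)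
  obtain ⟨η, hη, hlim⟩ := (isCompact_sphere (0 : EuclideanSpace ℝ (Fin k)) 1).ultrafilter_le_nhds
    (l.map fun n ↦ (‖(q n).2 - (q n).1‖)⁻¹ • ((q n).2 - (q n).1))
    (tendsto_principal.2 (Eventually.of_forall fun n ↦ by
      rw [mem_sphere_zero_iff_norm, norm_smul, norm_inv, norm_norm, inv_mul_cancel₀ (hpos n).ne']))
  have hη0 : η ≠ 0 := by
    rintro rfl
    simp at hη
  have hdir := HasDirection.of_contMDiffWithinAt hBconv hBint hp₁ (hφ p₁ hp₁) h1' h2' hlim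
  rcases hcone p₁ hp₁ η with ⟨u, hu, v, hv, huv, hlt⟩ | h0
  · obtain ⟨n, hn⟩ := (hdir.eventually_isConePair hσs hσ hS hW (Eventually.of_forall hpos)
      (hDW (mem_image_of_mem φ hp₁)) hu hv huv hlt).exists
    exact hqn n hn
  · refine hη0 (hder p₁ hp₁ ?_)
    rw [mem_singleton_iff.1 h0]
    exact (map_zero (mfderivWithin (𝓡 k) (𝓡 d) φ B p₁)).symm

end Disk

/-! ### Domination -/

section Domination

variable {d : ℕ} {M : Type*} [EMetricSpace M] [ChartedSpace (EuclideanSpace ℝ (Fin d)) M]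
  {S : Set M} {g : M ≃ₘ^1⟮𝓡 d, 𝓡 d⟯ M}

lemma contMDiff_iterate (g : M ≃ₘ^1⟮𝓡 d, 𝓡 d⟯ M) (n : ℕ) :
    ContMDiff (𝓡 d) (𝓡 d) 1 (g^[n]) := by
  induction n with
  | zero => exact contMDiff_id
  | succ n ih => exact ih.comp g.contMDiff

lemma mfderiv_iterate_succ (g : M ≃ₘ^1⟮𝓡 d, 𝓡 d⟯ M) (n : ℕ) (x : M) :
    mfderiv (𝓡 d) (𝓡 d) (g^[n + 1]) x =
      (mfderiv (𝓡 d) (𝓡 d) (g^[n]) (g x)).comp (mfderiv (𝓡 d) (𝓡 d) g x) :=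
  mfderiv_comp x ((contMDiff_iterate g n).contMDiffAt.mdifferentiableAt one_ne_zero)
    (g.contMDiff.contMDiffAt.mdifferentiableAt one_ne_zero)

lemma mfderiv_iterate_injective (g : M ≃ₘ^1⟮𝓡 d, 𝓡 d⟯ M) (n : ℕ) (x : M) :
    Function.Injective (mfderiv (𝓡 d) (𝓡 d) (g^[n]) x) := by
  induction n generalizing x with
  | zero =>
    rw [Function.iterate_zero, mfderiv_id]
    exact Function.injective_id
  | succ n ih =>
    rw [mfderiv_iterate_succ]
    refine (ih (g x)).comp ?_
    rw [← g.mfderivToContinuousLinearEquiv_coe one_ne_zero]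
    exact (g.mfderivToContinuousLinearEquiv one_ne_zero x).injective

lemma mfderiv_iterate_mem {B : (x : M) → Submodule ℝ (TangentSpace (𝓡 d) x)}
    (hB : ∀ x ∈ S, (B x).map (mfderiv (𝓡 d) (𝓡 d) g x).toLinearMap = B (g x))
    (hS : MapsTo g S S) (n : ℕ) {x : M} (hx : x ∈ S) {u : TangentSpace (𝓡 d) x} (hu : u ∈ B x) :
    mfderiv (𝓡 d) (𝓡 d) (g^[n]) x u ∈ B (g^[n] x) := by
  induction n generalizing x with
  | zero =>
    rw [Function.iterate_zero, mfderiv_id]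
    exact hu
  | succ n ih =>
    rw [mfderiv_iterate_succ]
    refine ih (hS hx) ?_
    rw [← hB x hx]
    exact Submodule.mem_map_of_mem hu

variable [RiemannianBundle (fun x : M ↦ TangentSpace (𝓡 d) x)]
  {E F : (x : M) → Submodule ℝ (TangentSpace (𝓡 d) x)}

/-- Some iterate of the map sends the closed cones of width `a` into the open ones. -/
lemma IsDominatedOn.exists_iterate_cone (h : IsDominatedOn g E F S) (hS : MapsTo g S S) {a : ℝ}
    (ha : 0 < a) : ∃ L : ℕ, 0 < L ∧ ∀ x ∈ S, ∀ u ∈ E x, ∀ v ∈ F x, ‖u‖ ≤ a * ‖v‖ → u + v ≠ 0 →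
      ∃ u' ∈ E (g^[L] x), ∃ v' ∈ F (g^[L] x),
        mfderiv (𝓡 d) (𝓡 d) (g^[L]) x (u + v) = u' + v' ∧ ‖u'‖ < a * ‖v'‖ := by
  obtain ⟨L, hL, hdom⟩ := h.dominated
  refine ⟨L, hL, fun x hx u hu v hv huv hne ↦ ⟨_, mfderiv_iterate_mem h.map_left hS L hx hu, _,
    mfderiv_iterate_mem h.map_right hS L hx hv, map_add _ _ _, ?_⟩⟩
  have hv0 : v ≠ 0 := by
    rintro rfl
    rw [norm_zero, mul_zero] at huv
    exact hne (by rw [norm_le_zero_iff.1 huv, add_zero])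
  have hv1 : 0 < ‖v‖ := norm_pos_iff.2 hv0
  have hv' : 0 < ‖mfderiv (𝓡 d) (𝓡 d) (g^[L]) x v‖ := by
    refine norm_pos_iff.2 fun h0 ↦ hv0 (mfderiv_iterate_injective g L x ?_)
    rw [h0, map_zero]
  by_cases hu0 : u = 0
  · rw [hu0, map_zero, norm_zero]
    exact mul_pos ha hv'
  · have h1 := hdom x hx u hu v hv hu0 hv0
    rw [div_le_iff₀ (norm_pos_iff.2 hu0)] at h1
    refine h1.trans_lt ?_
    have h2 : ‖mfderiv (𝓡 d) (𝓡 d) (g^[L]) x v‖ / ‖v‖ * ‖u‖ ≤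
        a * ‖mfderiv (𝓡 d) (𝓡 d) (g^[L]) x v‖ := by
      rw [div_mul_eq_mul_div, div_le_iff₀ hv1]
      nlinarith
    nlinarith [mul_pos ha hv']

end Domination

/-! ### Uniform local estimates and dynamical covers -/

section Entropy

/-- A local property of small sets holds uniformly near a compact set. -/
lemma exists_isOpen_forall_eball {X : Type*} [PseudoEMetricSpace X] {Λ : Set X} (hΛ : IsCompact Λ)
    {P : Set X → ENNReal → Prop} (hP : ∀ ⦃N N' C C'⦄, N' ⊆ N → C ≤ C' → P N C → P N' C')
    (h : ∀ x ∈ Λ, ∃ N ∈ 𝓝 x, ∃ C, C ≠ ⊤ ∧ P N C) :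
    ∃ U, IsOpen U ∧ Λ ⊆ U ∧ ∃ δ > 0, ∃ C, C ≠ ⊤ ∧ ∀ y ∈ U, P (Metric.eball y δ) C := by
  refine hΛ.induction_on (p := fun S ↦ ∃ U, IsOpen U ∧ S ⊆ U ∧ ∃ δ > 0, ∃ C, C ≠ ⊤ ∧
    ∀ y ∈ U, P (Metric.eball y δ) C) ?_ ?_ ?_ ?_
  · exact ⟨∅, isOpen_empty, Subset.rfl, 1, one_pos, 0, ENNReal.zero_ne_top, fun y hy ↦ hy.elim⟩
  · rintro s t hst ⟨U, hU, htU, h⟩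
    exact ⟨U, hU, hst.trans htU, h⟩
  · rintro s t ⟨U, hU, hsU, δ, hδ, C, hC, h⟩ ⟨U', hU', htU', δ', hδ', C', hC', h'⟩
    refine ⟨U ∪ U', hU.union hU', union_subset_union hsU htU', min δ δ', lt_min hδ hδ', max C C',
      (max_lt hC.lt_top hC'.lt_top).ne, ?_⟩
    rintro y (hy | hy)
    · exact hP (Metric.eball_subset_eball (min_le_left _ _)) (le_max_left _ _) (h y hy)
    · exact hP (Metric.eball_subset_eball (min_le_right _ _)) (le_max_right _ _) (h' y hy)
  · intro x hx
    obtain ⟨N, hN, C, hC, hNC⟩ := h x hx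
    obtain ⟨δ, hδ, hball⟩ := EMetric.mem_nhds_iff.1 hN
    have hδ2 : 0 < δ / 2 := ENNReal.half_pos hδ.ne'
    refine ⟨Metric.eball x (δ / 2), mem_nhdsWithin_of_mem_nhds (Metric.eball_mem_nhds x hδ2),
      Metric.eball x (δ / 2), Metric.isOpen_eball, Subset.rfl, δ / 2, hδ2, C, hC, fun y hy ↦ ?_⟩
    refine hP (Subset.trans (fun z hz ↦ ?_) hball) le_rfl hNC
    rw [Metric.mem_eball] at hy hz ⊢
    calc edist z x ≤ edist z y + edist y x := edist_triangle _ _ _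
      _ < δ / 2 + δ / 2 := ENNReal.add_lt_add hz hy
      _ = δ := ENNReal.add_halves δ

/-- If the images under `g^[n]` of the parts of `D` which stay `ε`-close up to time `n` have bounded
measure, then the growth rate of the measure of `g^[n] '' D` is at most the entropy of `g` on
`D`. -/
lemma diskVolumeExpansion_le_coverEntropy {M : Type*} [EMetricSpace M] [MeasurableSpace M]
    [BorelSpace M] (g : M → M) (k : ℕ) {D : Set M} {ε C : ENNReal} (hε : 0 < ε) (hC : C ≠ ⊤)
    (h : ∀ n, 0 < n → ∀ A ⊆ D, (∀ y ∈ A, ∀ z ∈ A, ∀ i < n, edist (g^[i] y) (g^[i] z) < ε) →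
      μHE[k] (g^[n] '' A) ≤ C) :
    diskVolumeExpansion g k D ≤ Dynamics.coverEntropy g D := by
  let V : SetRel M M := {p | edist p.1 p.2 < ε / 2}
  refine le_trans ?_ (Dynamics.coverEntropyEntourage_le_coverEntropy g D
    (edist_mem_uniformity (ENNReal.half_pos hε.ne') : V ∈ uniformity M))
  refine ExpGrowth.expGrowthSup_le_of_eventually_le (b := C + 1) (by finiteness) ?_
  filter_upwards [eventually_gt_atTop 0] with n hn
  -- the constant is `C + 1` so that the bound also holds when there is no finite cover: `0 * ⊤ = 0`
  rcases eq_or_ne (Dynamics.coverMincard g D V n) ⊤ with htop | hfin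
  · rw [htop, ENat.toENNReal_top, ENNReal.mul_top (by simp)]
    exact le_top
  obtain ⟨s, hs, hcard⟩ := (Dynamics.coverMincard_finite_iff g D V n).1 hfin.lt_top
  -- points in the same dynamical ball of radius `ε / 2` stay `ε`-close
  let A : M → Set M := fun c ↦ {y ∈ D | (y, c) ∈ Dynamics.dynEntourage g V n}
  have hD : g^[n] '' D ⊆ ⋃ c ∈ s, g^[n] '' A c := by
    rintro _ ⟨y, hy, rfl⟩
    obtain ⟨c, hc, hyc⟩ := hs hy
    exact mem_biUnion (s := (s : Set M)) hc (mem_image_of_mem _ ⟨hy, hyc⟩)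
  have hA : ∀ c, μHE[k] (g^[n] '' A c) ≤ C + 1 := by
    refine fun c ↦ (h n hn (A c) (fun y hy ↦ hy.1) fun y hy z hz i hi ↦ ?_).trans le_self_add
    have h1 : edist (g^[i] y) (g^[i] c) < ε / 2 := Dynamics.mem_dynEntourage.1 hy.2 i hi
    have h2 : edist (g^[i] z) (g^[i] c) < ε / 2 := Dynamics.mem_dynEntourage.1 hz.2 i hi
    rw [edist_comm] at h2
    calc edist (g^[i] y) (g^[i] z) ≤ _ := edist_triangle _ (g^[i] c) _
      _ < ε / 2 + ε / 2 := ENNReal.add_lt_add h1 h2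
      _ = ε := ENNReal.add_halves ε
  calc μHE[k] (g^[n] '' D) ≤ μHE[k] (⋃ c ∈ s, g^[n] '' A c) := measure_mono hD
    _ ≤ ∑ c ∈ s, μHE[k] (g^[n] '' A c) := measure_biUnion_finset_le _ _
    _ ≤ ∑ _c ∈ s, (C + 1) := Finset.sum_le_sum fun c _ ↦ hA c
    _ = (C + 1) * (Dynamics.coverMincard g D V n : ENNReal) := by
      rw [Finset.sum_const, nsmul_eq_mul, mul_comm, ← hcard]
      rfl

end Entropy

/-! ### Volume growth of disks tangent to the cone field -/

section Main

variable {d : ℕ} {M : Type*} [EMetricSpace M] [CompactSpace M]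
  [ChartedSpace (EuclideanSpace ℝ (Fin d)) M] [IsManifold (𝓡 d) 1 M]
  [RiemannianBundle (fun x : M ↦ TangentSpace (𝓡 d) x)]
  [IsContinuousRiemannianBundle (EuclideanSpace ℝ (Fin d)) (fun x : M ↦ TangentSpace (𝓡 d) x)]
  [IsRiemannianManifold (𝓡 d) M] [MeasurableSpace M] [BorelSpace M]

/-- Near a compact invariant set with a dominated splitting, the volume growth of the disks tangent
to the cone field is bounded by the entropy. -/
lemma exists_isOpen_volumeExpansion_le (g : M ≃ₘ^1⟮𝓡 d, 𝓡 d⟯ M)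
    {E F : (x : M) → Submodule ℝ (TangentSpace (𝓡 d) x)} {m k : ℕ} {Λ W : Set M}
    (hΛ : IsCompact Λ) (hgΛ : MapsTo g Λ Λ) (hW : IsOpen W) (hΛW : Λ ⊆ W)
    (hS : IsContinuousSplittingOn E F m k W) (hdom : IsDominatedOn g E F Λ) {a : ℝ} (ha : 0 < a) :
    ∃ U : Set M, IsOpen U ∧ Λ ⊆ U ∧ U ⊆ W ∧ ∀ V ⊆ U,
      volumeExpansion g E F k a V ≤ Dynamics.coverEntropy g {x | ∀ n : ℕ, g^[n] x ∈ V} := by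
  obtain ⟨s, σ, hσs, hσ⟩ := exists_chart_selection d M
  obtain ⟨L, hL, hcone⟩ := hdom.exists_iterate_cone hgΛ ha
  have hloc : ∀ x ∈ Λ, ∃ N ∈ 𝓝 x, ∃ C : ENNReal, C ≠ ⊤ ∧ (N ⊆ W ∧
      (∀ y ∈ N, ∀ z ∈ N, IsConePair E F a σ y z → IsConePair E F a σ (g^[L] y) (g^[L] z)) ∧
      ∀ A ⊆ N, (∀ y ∈ A, ∀ z ∈ A, IsConePair E F a σ y z) →
        ∀ r ∈ Finset.range (L + 1), μHE[k] (g^[r] '' A) ≤ C) := by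
    intro x hx
    have h1 := eventually_isConePair_map hσs hσ hS hW (hΛW hx) (hΛW (hgΛ.iterate L hx))
      (contMDiff_iterate g L).contMDiffAt (hcone x hx)
    rw [nhds_prod_eq] at h1
    obtain ⟨N₁, hN₁, hN₁'⟩ := mem_prod_self_iff.1 h1
    choose N hN C hC hNC using fun r : ℕ ↦ exists_measure_image_le_of_isConePair (a := a) hσs hσ hS
      hW (hΛW hx) (contMDiff_iterate g r).contMDiffAt
    refine ⟨W ∩ N₁ ∩ ⋂ r ∈ Finset.range (L + 1), N r,
      inter_mem (inter_mem (hW.mem_nhds (hΛW hx)) hN₁)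
        ((biInter_finset_mem _).2 fun r _ ↦ hN r),
      ∑ r ∈ Finset.range (L + 1), C r, ENNReal.sum_ne_top.2 fun r _ ↦ hC r,
      fun y hy ↦ hy.1.1, fun y hy z hz ↦ hN₁' (mk_mem_prod hy.1.2 hz.1.2), fun A hA hAc r hr ↦ ?_⟩
    exact (hNC r A (fun y hy ↦ mem_iInter₂.1 (hA hy).2 r hr) hAc).trans
      (Finset.single_le_sum (f := C) (fun _ _ ↦ zero_le) hr)
  obtain ⟨U, hU, hΛU, δ, hδ, C, hC, hUδ⟩ := exists_isOpen_forall_eball hΛ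
    (P := fun N C ↦ N ⊆ W ∧
      (∀ y ∈ N, ∀ z ∈ N, IsConePair E F a σ y z → IsConePair E F a σ (g^[L] y) (g^[L] z)) ∧
      ∀ A ⊆ N, (∀ y ∈ A, ∀ z ∈ A, IsConePair E F a σ y z) →
        ∀ r ∈ Finset.range (L + 1), μHE[k] (g^[r] '' A) ≤ C)
    (fun N N' C C' hN hCC h ↦ ⟨hN.trans h.1, fun y hy z hz ↦ h.2.1 y (hN hy) z (hN hz),
      fun A hA hAc r hr ↦ (h.2.2 A (hA.trans hN) hAc r hr).trans hCC⟩) hloc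
  have hUW : U ⊆ W := fun y hy ↦ (hUδ y hy).1 (Metric.mem_eball_self hδ)
  refine ⟨U, hU, hΛU, hUW, fun V hV ↦ iSup₂_le fun D hD ↦ ?_⟩
  obtain ⟨hDcone, hDV⟩ := hD
  have hDmem : ∀ y ∈ D, ∀ n, g^[n] y ∈ V := fun y hy n ↦ hDV n (mem_image_of_mem _ hy)
  refine le_trans ?_ (Dynamics.coverEntropy_monotone g (show D ⊆ _ from hDmem))
  obtain ⟨ε, hε, hDε⟩ := hDcone.exists_forall_isConePair hσs hσ hS hW
    fun y hy ↦ hUW (hV (hDmem y hy 0))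
  refine diskVolumeExpansion_le_coverEntropy g k (lt_min hε hδ) hC fun n hn A hAD hA ↦ ?_
  -- write `n = L * q + r` with `0 < r ≤ L`: the times `L * j` with `j ≤ q` are smaller than `n`
  obtain ⟨q, r, hr, hlt, rfl⟩ : ∃ q r, r ∈ Finset.range (L + 1) ∧ L * q < n ∧ r + L * q = n := by
    refine ⟨(n - 1) / L, (n - 1) % L + 1, ?_, ?_, ?_⟩
    · have := Nat.mod_lt (n - 1) hL
      rw [Finset.mem_range]
      omega
    · have := Nat.div_add_mod (n - 1) L
      omega
    · have := Nat.div_add_mod (n - 1) L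
      omega
  have hiter : ∀ j ≤ q, ∀ y ∈ A, ∀ z ∈ A, IsConePair E F a σ (g^[L * j] y) (g^[L * j] z) := by
    intro j
    induction j with
    | zero =>
      exact fun _ y hy z hz ↦ hDε y (hAD hy) z (hAD hz)
        ((hA y hy z hz 0 hn).trans_le (min_le_left _ _))
    | succ j ih =>
      intro hj y hy z hz
      have hjlt : L * j < r + L * q :=
        (Nat.mul_le_mul_left L (Nat.le_of_succ_le hj)).trans_lt hlt
      have h1 := (hUδ _ (hV (hDmem y (hAD hy) (L * j)))).2.1 _ (Metric.mem_eball_self hδ)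
        (g^[L * j] z) (by
          rw [Metric.mem_eball]
          exact (hA z hz y hy _ hjlt).trans_le (min_le_right _ _))
        (ih (Nat.le_of_succ_le hj) y hy z hz)
      rwa [← Function.iterate_add_apply, ← Function.iterate_add_apply, add_comm,
        ← Nat.mul_succ] at h1
  rcases A.eq_empty_or_nonempty with rfl | ⟨y₀, hy₀⟩
  · simp
  rw [Function.iterate_add, image_comp]
  refine (hUδ _ (hV (hDmem y₀ (hAD hy₀) (L * q)))).2.2 _ ?_ ?_ r hr
  · rintro _ ⟨y, hy, rfl⟩
    rw [Metric.mem_eball]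
    exact (hA y hy y₀ hy₀ _ hlt).trans_le (min_le_right _ _)
  · rintro _ ⟨y, hy, rfl⟩ _ ⟨z, hz, rfl⟩
    exact hiter q le_rfl y hy z hz

end Main
end VolumeGrowth

open VolumeGrowth
theorem theoremt {d : ℕ} {M : Type*} [EMetricSpace M] [CompactSpace M]
    [ChartedSpace (EuclideanSpace ℝ (Fin d)) M] [IsManifold (𝓡 d) ∞ M]
    [RiemannianBundle (fun x : M ↦ TangentSpace (𝓡 d) x)]
    [IsContMDiffRiemannianBundle (𝓡 d) ∞ (EuclideanSpace ℝ (Fin d))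
      (fun x : M ↦ TangentSpace (𝓡 d) x)]
    [IsRiemannianManifold (𝓡 d) M] [MeasurableSpace M] [BorelSpace M]
    (g : M ≃ₘ^1⟮𝓡 d, 𝓡 d⟯ M)
    (E F : (x : M) → Submodule ℝ (TangentSpace (𝓡 d) x)) (m k : ℕ) :
    -- a dominated splitting on the whole manifold
    (IsContinuousSplittingOn E F m k univ → IsDominatedOn g E F univ →
      ∀ a : ℝ, 0 < a → volumeExpansion g E F k a univ ≤ Dynamics.coverEntropy g univ) ∧
    -- a dominated splitting on a compact invariant set, extended to a neighborhood
    (∀ Λ W : Set M, IsCompact Λ → g '' Λ = Λ → IsOpen W → Λ ⊆ W →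
      IsContinuousSplittingOn E F m k W → IsDominatedOn g E F Λ →
      ∀ a : ℝ, 0 < a → ∃ U : Set M, IsOpen U ∧ Λ ⊆ U ∧ U ⊆ W ∧ ∀ V ⊆ U,
        volumeExpansion g E F k a V ≤ Dynamics.coverEntropy g {x | ∀ n : ℕ, g^[n] x ∈ V} ∧
        volumeExpansion g E F k a V ≤ Dynamics.coverEntropy g univ) := by
  have := isContinuousRiemannianBundle_of_contMDiff (V' := EuclideanSpace ℝ (Fin d)) (𝓡 d) ∞
    (fun x : M ↦ TangentSpace (𝓡 d) x)
  constructor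
  · intro hS hdom a ha
    obtain ⟨U, -, hU, -, h⟩ := exists_isOpen_volumeExpansion_le g isCompact_univ (mapsTo_univ g _)
      isOpen_univ Subset.rfl hS hdom ha
    exact (h univ hU).trans (Dynamics.coverEntropy_monotone g (subset_univ _))
  · intro Λ W hΛ hgΛ hW hΛW hS hdom a ha
    obtain ⟨U, hU, hΛU, hUW, h⟩ := exists_isOpen_volumeExpansion_le g hΛ
      (mapsTo_iff_image_subset.2 hgΛ.subset) hW hΛW hS hdom ha
    exact ⟨U, hU, hΛU, hUW, fun V hV ↦ ⟨h V hV,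
      (h V hV).trans (Dynamics.coverEntropy_monotone g (subset_univ _))⟩⟩
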